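/- Let $R$ and $S$ be complete, separated two-sided linear topological rings (associative and unital; the open two-sided ideals form a base of neighbourhoods of zero) with countable bases of neighbourhoods of zero, and let $f\colon R\to S$ be a continuous ring homomorphism that is *strongly right taut*: the open two-sided ideals $I\subset R$ for which the closure in $S$ of the right ideal $f(I)S$ is an open two-sided ideal of $S$ form a base of neighbourhoods of zero in $R$. For a set $X$, let $R[[X]]$ be the set of formal sums $\sum_{x\in X}r_x x$ whose family of coefficients $r_x\in R$ converges to zero. A left $R$-contramodule is an algebra $P$ over the monad $X\mapsto R[[X]]$ on the category of sets, with contraaction map $\pi_P\colon R[[P]]\to P$; it has an underlying left $R$-module. For an open right ideal or an open two-sided ideal $I\subset R$, let $I\rightthreetimes P\subset P$ be the image under $\pi_P$ of the formal sums with coefficients in $I$. The contramodule $P$ is separated if $\bigcap_I (I\rightthreetimes P)=0$, where $I$ ranges over the open right ideals of $R$. Restriction of scalars along $f$ (composition of the contraaction with $R[[Q]]\to S[[Q]]$) defines a functor $f_\sharp$ from separated left $S$-contramodules to separated left $R$-contramodules. The ring $S$ is a left $S$-contramodule (with infinite sums taken in its topology), hence also a left $R$-contramodule; for a left $R$-contramodule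 $P$, let $\operatorname{Hom}^R(S,P)$ be the set of left $R$-contramodule morphisms $S\to P$, with the left $S$-module structure given by pointwise addition and $(sg)(t)=g(ts)$. Then every set $\operatorname{Hom}^R(S,P)$, where $P$ is a separated left $R$-contramodule, can be given the structure of a separated left $S$-contramodule, functorially in $P$ (with respect to composition with morphisms $P\to P'$), so that the following hold. 1. The underlying left $S$-module of this contramodule is $\operatorname{Hom}^R(S,P)$ with the left $S$-module structure above. 2. There exist descending chains of open two-sided ideals $(I_n)_{n\ge 0}$ in $R$ and $(J_n)_{n\ge0}$ in $S$, forming bases of neighbourhoods of zero, such that $J_n$ is the closure of $f(I_n)S$ for every $n$. For any such chains, put $R_n=R/I_n$, $S_n=S/J_n$ and $P_n=P/(I_n\rightthreetimes P)$. Then the maps $\operatorname{Hom}^R(S,P)\to\operatorname{Hom}_{R_n}(S_n,P_n)$ induced by passage to the quotients are well defined, they are morphisms of left $S$-contramodules (a left $S_n$-module being viewed as a left $S$-contramodule), and they identify $\operatorname{Hom}^R(S,P)$ with $\varprojlim_n\operatorname{Hom}_{R_n}(S_n,P_n)$. 3. The resulting functor $P\mapsto\operatorname{Hom}^R(S,P)$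 from separated left $R$-contramodules to separated left $S$-contramodules is right adjoint to $f_\sharp$, by an adjunction whose counit is the map $\operatorname{Hom}^R(S,P)\to\operatorname{Hom}^R(R,P)\simeq P$ induced by the left $R$-contramodule morphism $f\colon R\to S$; that is, the counit takes $h$ to $h(1)$. -/

import Mathlib

open Filter Topology CategoryTheory MulOpposite

set_option linter.unusedSectionVars false
set_option linter.style.haveILetI false

universe u v

noncomputable section

namespace Contramodules

/-! ### Zero-convergent families and infinite sums -/

/-- `FormalSum A X` is the abelian group `A[[X]]` of infinite formal linear combinations
`∑ aₓ x` of elements of `X` whose family of coefficients converges to zero in `A`: for every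
neighbourhood `U` of zero, all but finitely many of the `aₓ` lie in `U`. -/
def FormalSum (A : Type u) [AddCommGroup A] [TopologicalSpace A] [IsTopologicalAddGroup A]
    (X : Type v) : AddSubgroup (X → A) where
  carrier := {a | Tendsto a cofinite (𝓝 0)}
  zero_mem' := tendsto_const_nhds
  add_mem' {a b} ha hb := by
    have : Tendsto (fun x => a x + b x) cofinite (𝓝 (0 + 0)) := Tendsto.add ha hb
    rwa [add_zero] at this
  neg_mem' {a} ha := by
    have : Tendsto (fun x => - a x) cofinite (𝓝 (-0)) := Tendsto.neg ha
    rwa [neg_zero] at this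

theorem nonarchimedean_of_linear (R : Type u) [Ring R] [TopologicalSpace R] [IsTopologicalRing R]
    [IsLinearTopology Rᵐᵒᵖ R] : NonarchimedeanAddGroup R where
  is_nonarchimedean U hU := by
    obtain ⟨N, hN, hNU⟩ := (IsLinearTopology.hasBasis_open_submodule Rᵐᵒᵖ).mem_iff.1 hU
    exact ⟨⟨N.toAddSubgroup, hN⟩, hNU⟩

/-- Auxiliary: topological left `R`-modules in which `∑ rₓ mₓ` converges for every zero-convergent
family `r` of elements of `R` and every family `m`. -/
structure Summing (R : Type u) [Ring R] [TopologicalSpace R]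
    (M : Type v) [AddCommGroup M] [Module R M] [UniformSpace M] : Prop where
  nonarch : NonarchimedeanAddGroup M
  unif : ∀ U ∈ 𝓝 (0 : M), ∃ V ∈ 𝓝 (0 : R), ∀ r ∈ V, ∀ m : M, r • m ∈ U
  cont : ∀ r : R, Continuous fun m : M => r • m

section Summing

variable {R : Type u} [Ring R] [UniformSpace R] [IsUniformAddGroup R] [IsTopologicalRing R]
  {M : Type v} [AddCommGroup M] [Module R M] [UniformSpace M] [IsUniformAddGroup M]
  [CompleteSpace M] [T2Space M] {X Y : Type*}

theorem Summing.tendsto (H : Summing R M) (a : FormalSum R X) (m : X → M) :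
    Tendsto (fun x => a.1 x • m x) cofinite (𝓝 0) := by
  intro U hU
  obtain ⟨V, hV, h⟩ := H.unif U hU
  exact mem_map.2 (mem_of_superset (show {x | a.1 x ∈ V} ∈ cofinite from a.2 hV)
    fun x hx => h (a.1 x) hx (m x))

theorem Summing.tendsto_prod (H : Summing R M) (a : FormalSum R X) (F : X → Y → M)
    (hF : ∀ x, Tendsto (F x) cofinite (𝓝 0)) :
    Tendsto (fun p : X × Y => a.1 p.1 • F p.1 p.2) cofinite (𝓝 0) := by
  intro U hU
  obtain ⟨V, hV, h⟩ := H.unif U hU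
  have h1 : {x | a.1 x ∉ V}.Finite := a.2 hV
  have h2 : ∀ x, {y | a.1 x • F x y ∉ U}.Finite := fun x => by
    have : Tendsto (fun y => a.1 x • F x y) cofinite (𝓝 (a.1 x • 0)) :=
      ((H.cont (a.1 x)).tendsto 0).comp (hF x)
    rw [smul_zero] at this
    exact this hU
  refine (h1.biUnion (t := fun x => (fun y => (x, y)) '' {y | a.1 x • F x y ∉ U})
    fun x _ => (h2 x).image _).subset ?_
  rintro ⟨x, y⟩ hxy
  have hxy' : a.1 x • F x y ∉ U := hxy
  simp only [Set.mem_iUnion]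
  exact ⟨x, fun hx => hxy' (h _ hx _), y, hxy', rfl⟩

theorem Summing.summable (H : Summing R M) {m : X → M} (h : Tendsto m cofinite (𝓝 0)) :
    Summable m :=
  have := H.nonarch
  NonarchimedeanAddGroup.summable_of_tendsto_cofinite_zero h

theorem Summing.tendsto_tsum (H : Summing R M) (a : FormalSum R X) (F : X → Y → M)
    (hF : ∀ x, Tendsto (F x) cofinite (𝓝 0)) :
    Tendsto (fun y => ∑' x, a.1 x • F x y) cofinite (𝓝 0) := by
  intro U hU
  have := H.nonarch
  obtain ⟨W, hW⟩ := NonarchimedeanAddGroup.is_nonarchimedean U hU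
  have h1 := H.tendsto_prod a F hF (W.mem_nhds_zero)
  refine ((show Set.Finite _ from h1).image Prod.snd).subset ?_
  intro y hy
  by_contra hcon
  apply hy
  apply hW
  have hmem : ∀ x, a.1 x • F x y ∈ W := fun x => by
    by_contra hx
    exact hcon ⟨(x, y), hx, rfl⟩
  have hs : HasSum (fun x => a.1 x • F x y) (∑' x, a.1 x • F x y) :=
    (H.summable (H.tendsto a fun x => F x y)).hasSum
  have hcl : IsClosed (W : Set M) := W.isClosed
  exact hcl.mem_of_tendsto hs (Eventually.of_forall fun s => sum_mem fun x _ => hmem x)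

theorem Summing.tsum_comm (H : Summing R M) (a : FormalSum R X) (F : X → Y → M)
    (hF : ∀ x, Tendsto (F x) cofinite (𝓝 0)) :
    ∑' y, ∑' x, a.1 x • F x y = ∑' x, a.1 x • ∑' y, F x y := by
  have h1 : Summable (Function.uncurry fun x y => a.1 x • F x y) :=
    H.summable (H.tendsto_prod a F hF)
  have h2 : ∀ x, Summable fun y => a.1 x • F x y := fun x => by
    apply H.summable
    have := ((H.cont (a.1 x)).tendsto 0).comp (hF x)
    rwa [smul_zero] at this
  have h3 : ∀ y, Summable fun x => a.1 x • F x y := fun y =>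
    H.summable (H.tendsto a fun x => F x y)
  rw [h1.tsum_comm' h2 h3]
  exact tsum_congr fun x =>
    ((H.summable (hF x)).map_tsum (DistribSMul.toAddMonoidHom M (a.1 x)) (H.cont (a.1 x))).symm

end Summing

/-! ### The monad `X ↦ R[[X]]` -/

section Monad

variable (R : Type u) [Ring R] [UniformSpace R] [IsUniformAddGroup R] [IsTopologicalRing R]
  [IsLinearTopology Rᵐᵒᵖ R]

theorem summing_self : Summing R R where
  nonarch := nonarchimedean_of_linear R
  unif U hU := by
    obtain ⟨N, hN, hNU⟩ := (IsLinearTopology.hasBasis_open_submodule Rᵐᵒᵖ).mem_iff.1 hU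
    exact ⟨N, hN.mem_nhds N.zero_mem, fun r hr m => hNU (N.smul_mem (op m) hr)⟩
  cont r := continuous_const_mul r

variable {R} [CompleteSpace R] [T2Space R] {X Y Z : Type*}

namespace FormalSum

/-- The unit `X → R[[X]]`, taking `x` to the formal linear combination `1 x`. -/
def single (x : X) : FormalSum R X :=
  ⟨fun y => open Classical in if y = x then 1 else 0, by
    refine Tendsto.congr' ?_ tendsto_const_nhds
    refine mem_of_superset (Set.finite_singleton x).compl_mem_cofinite fun y hy => ?_
    exact (if_neg hy).symm⟩

/-- Auxiliary: `∑ₓ aₓ (k x)`. -/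
def bind (a : FormalSum R X) (k : X → FormalSum R Y) : FormalSum R Y :=
  ⟨fun y => ∑' x, a.1 x * (k x).1 y,
    (summing_self R).tendsto_tsum a (fun x => (k x).1) fun x => (k x).2⟩

theorem fiber_tsum (a : FormalSum R X) (f : X → Y) (y : Y) :
    ∑' x : {x // f x = y}, a.1 x = (bind a fun x => single (f x)).1 y := by
  refine (tsum_subtype {x | f x = y} a.1).trans (tsum_congr fun x => ?_)
  by_cases h : f x = y
  · rw [Set.indicator_of_mem (show x ∈ {x | f x = y} from h)]
    simp [single, h]
  · rw [Set.indicator_of_notMem (show x ∉ {x | f x = y} from h)]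
    have h' : y ≠ f x := fun e => h e.symm
    simp [single, h']

/-- The map `R[[f]] : R[[X]] → R[[Y]]` induced by `f : X → Y`, taking `∑ₓ aₓ x` to
`∑ᵧ bᵧ y` with `bᵧ = ∑_{f x = y} aₓ`. -/
def map (f : X → Y) (a : FormalSum R X) : FormalSum R Y :=
  ⟨fun y => ∑' x : {x // f x = y}, a.1 x, by
    rw [show (fun y => ∑' x : {x // f x = y}, a.1 x) = (bind a fun x => single (f x)).1 from
      funext fun y => fiber_tsum a f y]
    exact (bind a fun x => single (f x)).2⟩

/-- The opening of parentheses `R[[R[[X]]]] → R[[X]]`. -/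
def join (z : FormalSum R (FormalSum R X)) : FormalSum R X :=
  ⟨fun x => ∑' a : FormalSum R X, z.1 a * a.1 x,
    (summing_self R).tendsto_tsum z (fun a => a.1) fun a => a.2⟩

theorem map_eq_bind (f : X → Y) (a : FormalSum R X) : map f a = bind a fun x => single (f x) :=
  Subtype.ext (funext fun y => fiber_tsum a f y)

theorem tsum_single {M : Type*} [AddCommGroup M] [Module R M] [TopologicalSpace M] [T2Space M]
    (x : X) (m : X → M) : ∑' y, (single (R := R) x).1 y • m y = m x := by
  rw [tsum_eq_single x fun y hy => by simp [single, hy]]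
  simp [single]

theorem tsum_bind {M : Type*} [AddCommGroup M] [Module R M] [UniformSpace M]
    [IsUniformAddGroup M] [CompleteSpace M] [T2Space M] (H : Summing R M)
    (a : FormalSum R X) (k : X → FormalSum R Y) (m : Y → M) :
    ∑' y, (bind a k).1 y • m y = ∑' x, a.1 x • ∑' y, (k x).1 y • m y := by
  rw [← H.tsum_comm a (fun x y => (k x).1 y • m y) fun x => H.tendsto (k x) m]
  refine tsum_congr fun y => ?_
  have hc : Continuous fun r : R => r • m y := by
    refine continuous_of_continuousAt_zero ((AddMonoidHom.mk' (fun r : R => r • m y)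
      fun r s => add_smul r s _)) ?_
    intro U hU
    rw [_root_.map_zero] at hU
    obtain ⟨V, hV, h⟩ := H.unif U hU
    exact mem_map.2 (mem_of_superset hV fun r hr => h r hr (m y))
  have h2 := ((summing_self R).summable
    ((summing_self R).tendsto a fun x => (k x).1 y)).map_tsum
      (AddMonoidHom.mk' (fun r : R => r • m y) fun r s => add_smul r s _) hc
  simp only [AddMonoidHom.mk'_apply, smul_eq_mul, mul_smul] at h2
  exact h2

theorem bind_bind (a : FormalSum R X) (k : X → FormalSum R Y) (l : Y → FormalSum R Z) :
    bind (bind a k) l = bind a fun x => bind (k x) l :=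
  Subtype.ext (funext fun z => tsum_bind (summing_self R) a k fun y => (l y).1 z)

theorem single_bind (x : X) (k : X → FormalSum R Y) : bind (single x) k = k x :=
  Subtype.ext (funext fun y => tsum_single (R := R) x fun x => (k x).1 y)

theorem bind_single (a : FormalSum R X) : bind a single = a := by
  refine Subtype.ext (funext fun y => ?_)
  change ∑' x, a.1 x * (single x).1 y = a.1 y
  rw [tsum_eq_single y fun x hx => by simp [single, hx.symm]]
  simp [single]

theorem join_eq_bind (z : FormalSum R (FormalSum R X)) : join z = bind z id := rfl

theorem map_id (a : FormalSum R X) : map id a = a := by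
  rw [map_eq_bind]; exact bind_single a

theorem map_map (g : Y → Z) (f : X → Y) (a : FormalSum R X) :
    map g (map f a) = map (g ∘ f) a := by
  simp only [map_eq_bind, bind_bind, single_bind, Function.comp]

theorem map_single (f : X → Y) (x : X) : map f (single (R := R) x) = single (f x) := by
  rw [map_eq_bind, single_bind]

theorem join_map (k : X → FormalSum R Y) (a : FormalSum R X) : join (map k a) = bind a k := by
  simp only [map_eq_bind, join_eq_bind, bind_bind, single_bind, id]

theorem bind_add (a b : FormalSum R X) (k : X → FormalSum R Y) :
    bind (a + b) k = bind a k + bind b k := by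
  refine Subtype.ext (funext fun y => ?_)
  change ∑' x, (a.1 x + b.1 x) * (k x).1 y = _
  simp only [add_mul]
  have h := fun c : FormalSum R X => (summing_self R).summable
    ((summing_self R).tendsto c fun x => (k x).1 y)
  exact (h a).tsum_add (h b)

theorem map_add (f : X → Y) (a b : FormalSum R X) : map f (a + b) = map f a + map f b := by
  simp only [map_eq_bind, bind_add]

theorem map_zero (f : X → Y) : map f (0 : FormalSum R X) = 0 := by
  have := map_add f (0 : FormalSum R X) 0
  simpa using this

theorem map_neg (f : X → Y) (a : FormalSum R X) : map f (-a) = -map f a := by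
  have := map_add f (-a) a
  rw [neg_add_cancel, map_zero] at this
  exact eq_neg_of_add_eq_zero_left this.symm

/-- The left `R`-module structure on `R[[X]]`, given by `r ∑ aₓ x = ∑ (r aₓ) x`. -/
instance : Module R (FormalSum R X) where
  smul r a := ⟨fun x => r * a.1 x, by
    have := ((summing_self R).cont r).tendsto 0 |>.comp a.2
    rwa [smul_zero] at this⟩
  one_smul a := Subtype.ext (funext fun x => one_mul _)
  mul_smul r s a := Subtype.ext (funext fun x => mul_assoc _ _ _)
  smul_zero r := Subtype.ext (funext fun x => mul_zero _)
  smul_add r a b := Subtype.ext (funext fun x => mul_add _ _ _)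
  add_smul r s a := Subtype.ext (funext fun x => add_mul _ _ _)
  zero_smul a := Subtype.ext (funext fun x => zero_mul _)

theorem smul_apply (r : R) (a : FormalSum R X) (x : X) : (r • a).1 x = r * a.1 x := rfl

theorem map_smul (f : X → Y) (r : R) (a : FormalSum R X) : map f (r • a) = r • map f a := by
  simp only [map_eq_bind]
  refine Subtype.ext (funext fun y => ?_)
  change ∑' x, (r * a.1 x) * (single (f x)).1 y = r * ∑' x, a.1 x * (single (f x)).1 y
  simp only [mul_assoc]
  exact (((summing_self R).summable
    ((summing_self R).tendsto a fun x => (single (f x)).1 y)).map_tsum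
    (AddMonoidHom.mulLeft r) (continuous_const_mul r)).symm

end FormalSum

end Monad

/-! ### Contramodules -/

section Contra

variable (R : Type u) [Ring R] [UniformSpace R] [IsUniformAddGroup R] [IsTopologicalRing R]
  [IsLinearTopology Rᵐᵒᵖ R] [CompleteSpace R] [T2Space R]

/-- A left `R`-contramodule structure on a set `P`, that is, a structure of algebra over the
monad `X ↦ R[[X]]`: a contraaction map satisfying contraunitality and contraassociativity. -/
structure ContraStr (P : Type v) where
  act : FormalSum R P → P
  act_single : ∀ p : P, act (FormalSum.single p) = p
  act_join : ∀ z : FormalSum R (FormalSum R P), act (FormalSum.join z) = act (FormalSum.map act z)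

/-- A left `R`-contramodule. -/
structure Contra where
  carrier : Type v
  str : ContraStr R carrier

namespace Contra

variable {R}

instance : CoeSort (Contra.{u, v} R) (Type v) := ⟨carrier⟩

/-- The contraaction map `R[[P]] → P`. -/
def act (P : Contra.{u, v} R) : FormalSum R P → P := P.str.act

/-- A morphism of left `R`-contramodules. -/
@[ext]
structure Hom (P Q : Contra.{u, v} R) where
  toFun : P → Q
  map_act : ∀ a : FormalSum R P, toFun (P.act a) = Q.act (FormalSum.map toFun a)

/-- The category of left `R`-contramodules. -/
instance : Category (Contra.{u, v} R) where
  Hom := Hom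
  id P := ⟨id, fun a => by rw [FormalSum.map_id]; rfl⟩
  comp g h := ⟨h.toFun ∘ g.toFun, fun a => by
    rw [Function.comp_apply, g.map_act, h.map_act, FormalSum.map_map]⟩

instance (P Q : Contra.{u, v} R) : CoeFun (P ⟶ Q) (fun _ => P → Q) := ⟨Hom.toFun⟩

variable (P : Contra.{u, v} R)

instance : Zero P := ⟨P.act 0⟩
instance : Add P := ⟨fun p q => P.act (FormalSum.single p + FormalSum.single q)⟩
instance : Neg P := ⟨fun p => P.act (-FormalSum.single p)⟩
instance : Sub P := ⟨fun p q => p + -q⟩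
instance : SMul R P := ⟨fun r p => P.act (r • FormalSum.single p)⟩

theorem act_single (p : P) : P.act (FormalSum.single p) = p := P.str.act_single p

theorem act_join (z : FormalSum R (FormalSum R P)) :
    P.act (FormalSum.join z) = P.act (FormalSum.map P.act z) := P.str.act_join z

theorem act_surjective : Function.Surjective P.act := fun p => ⟨_, P.act_single p⟩

theorem join_single (a : FormalSum R P) : FormalSum.join (FormalSum.single a) = a := by
  rw [FormalSum.join_eq_bind, FormalSum.single_bind]; rfl

theorem join_add (z w : FormalSum R (FormalSum R P)) :
    FormalSum.join (z + w) = FormalSum.join z + FormalSum.join w := FormalSum.bind_add z w id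

theorem act_add (a b : FormalSum R P) : P.act (a + b) = P.act a + P.act b := by
  change _ = P.act (FormalSum.single (P.act a) + FormalSum.single (P.act b))
  rw [← FormalSum.map_single P.act a, ← FormalSum.map_single P.act b, ← FormalSum.map_add,
    ← act_join, join_add, join_single, join_single]

theorem act_zero : P.act 0 = 0 := rfl

theorem act_neg (a : FormalSum R P) : P.act (-a) = -P.act a := by
  change _ = P.act (-FormalSum.single (P.act a))
  rw [← FormalSum.map_single P.act a, ← FormalSum.map_neg, ← act_join]
  congr 1
  have h := P.join_add (-FormalSum.single a) (FormalSum.single a)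
  rw [neg_add_cancel, join_single] at h
  have h0 : FormalSum.join (0 : FormalSum R (FormalSum R P)) = 0 := by
    have := P.join_add 0 0
    simpa using this
  rw [h0] at h
  exact (eq_neg_of_add_eq_zero_left h.symm).symm

theorem join_smul_single (r : R) (a : FormalSum R P) :
    FormalSum.join (r • FormalSum.single a) = r • a := by
  refine Subtype.ext (funext fun x => ?_)
  change ∑' b : FormalSum R P, (r * (FormalSum.single a).1 b) * b.1 x = r * a.1 x
  rw [tsum_eq_single a fun b hb => by simp [FormalSum.single, hb]]
  simp [FormalSum.single]

theorem act_smul (r : R) (a : FormalSum R P) : P.act (r • a) = r • P.act a := by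
  change _ = P.act (r • FormalSum.single (P.act a))
  rw [← FormalSum.map_single P.act a, ← FormalSum.map_smul, ← act_join, join_smul_single]

/-- The underlying abelian group of a contramodule: `p + q` is the value of the contraaction
map on the formal linear combination `1 p + 1 q`. -/
instance addCommGroup : AddCommGroup P where
  add_assoc p q r := by
    obtain ⟨a, rfl⟩ := P.act_surjective p
    obtain ⟨b, rfl⟩ := P.act_surjective q
    obtain ⟨c, rfl⟩ := P.act_surjective r
    simp only [← act_add, add_assoc]
  zero_add p := by
    obtain ⟨a, rfl⟩ := P.act_surjective p
    rw [← act_zero, ← act_add, zero_add]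
  add_zero p := by
    obtain ⟨a, rfl⟩ := P.act_surjective p
    rw [← act_zero, ← act_add, add_zero]
  add_comm p q := by
    obtain ⟨a, rfl⟩ := P.act_surjective p
    obtain ⟨b, rfl⟩ := P.act_surjective q
    simp only [← act_add, add_comm]
  nsmul := nsmulRec
  neg_add_cancel p := by
    obtain ⟨a, rfl⟩ := P.act_surjective p
    rw [← act_neg, ← act_add, neg_add_cancel, act_zero]
  zsmul := zsmulRec

/-- The underlying left `R`-module of a contramodule: `r p` is the value of the contraaction
map on the formal linear combination `r p`. -/
instance module : Module R P where
  one_smul p := by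
    obtain ⟨a, rfl⟩ := P.act_surjective p
    rw [← act_smul, one_smul]
  mul_smul r s p := by
    obtain ⟨a, rfl⟩ := P.act_surjective p
    simp only [← act_smul, mul_smul]
  smul_zero r := by rw [← act_zero, ← act_smul, smul_zero]
  smul_add r p q := by
    obtain ⟨a, rfl⟩ := P.act_surjective p
    obtain ⟨b, rfl⟩ := P.act_surjective q
    simp only [← act_smul, ← act_add, smul_add]
  add_smul r s p := by
    obtain ⟨a, rfl⟩ := P.act_surjective p
    simp only [← act_smul, ← act_add, add_smul]
  zero_smul p := by
    obtain ⟨a, rfl⟩ := P.act_surjective p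
    rw [← act_smul, zero_smul, act_zero]

/-- `P.tim A` is the subgroup `A ⋌ P` of `P`, the image of `A[[P]]` under the contraaction map,
for a subgroup `A` of `R`. -/
def tim (A : AddSubgroup R) : AddSubgroup P where
  carrier := {p | ∃ a : FormalSum R P, (∀ x, a.1 x ∈ A) ∧ P.act a = p}
  zero_mem' := ⟨0, fun _ => A.zero_mem, rfl⟩
  add_mem' := by
    rintro _ _ ⟨a, ha, rfl⟩ ⟨b, hb, rfl⟩
    exact ⟨a + b, fun x => A.add_mem (ha x) (hb x), P.act_add a b⟩
  neg_mem' := by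
    rintro _ ⟨a, ha, rfl⟩
    exact ⟨-a, fun x => A.neg_mem (ha x), P.act_neg a⟩

/-- For a left ideal `I` of `R`, the subgroup `I ⋌ P` is an `R`-submodule of `P`. -/
def timSubmodule (I : Ideal R) : Submodule R P where
  __ := P.tim I.toAddSubgroup
  smul_mem' := by
    rintro r _ ⟨a, ha, rfl⟩
    exact ⟨r • a, fun x => I.mul_mem_left r (ha x), P.act_smul r a⟩

theorem timSubmodule_mono {I I' : Ideal R} (h : I ≤ I') :
    P.timSubmodule I ≤ P.timSubmodule I' := by
  rintro _ ⟨a, ha, rfl⟩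
  exact ⟨a, fun x => h (ha x), rfl⟩

theorem smul_mem_tim {I : Ideal R} {r : R} (hr : r ∈ I) (p : P) : r • p ∈ P.timSubmodule I := by
  refine ⟨r • FormalSum.single p, fun x => ?_, rfl⟩
  rw [FormalSum.smul_apply]
  by_cases h : x = p
  · simpa [FormalSum.single, h] using hr
  · simp [FormalSum.single, h]

/-- The `R/I`-module structure on `P/(I ⋌ P)`, for a two-sided ideal `I` of `R`. -/
instance quotientModule (I : Ideal R) [I.IsTwoSided] :
    Module (R ⧸ I) (P ⧸ P.timSubmodule I) :=
  Module.IsTorsionBySet.module (M := P ⧸ P.timSubmodule I) (I := I) <| by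
    rintro x ⟨r, hr⟩
    obtain ⟨p, rfl⟩ := Submodule.Quotient.mk_surjective _ x
    exact (Submodule.Quotient.mk_eq_zero _).2 (P.smul_mem_tim hr p)

/-- A contramodule is separated if the intersection of the subgroups `I ⋌ P` over all the open
right ideals `I` of `R` vanishes, that is, if the map from `P` to `lim P/(I ⋌ P)` is injective. -/
def IsSeparated : ObjectProperty (Contra.{u, v} R) := fun P =>
  ∀ p : P, (∀ I : Submodule Rᵐᵒᵖ R, IsOpen (I : Set R) → p ∈ P.tim I.toAddSubgroup) → p = 0

/-- Auxiliary: the contramodule structure given by honest infinite sums. -/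
def ofSumming {M : Type v} [AddCommGroup M] [Module R M] [UniformSpace M]
    [IsUniformAddGroup M] [CompleteSpace M] [T2Space M] (H : Summing R M) : ContraStr R M where
  act a := ∑' m, a.1 m • m
  act_single m := FormalSum.tsum_single m id
  act_join z := by
    rw [FormalSum.join_eq_bind, FormalSum.map_eq_bind]
    refine (FormalSum.tsum_bind H z id id).trans
      (Eq.trans ?_ (FormalSum.tsum_bind H z _ id).symm)
    exact tsum_congr fun a => congrArg _ (FormalSum.tsum_single _ id).symm

variable (R) in
/-- The left `R`-contramodule `R`, in which `∑ rₛ s` is evaluated as an infinite sum in the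
topology of `R`. -/
def self : Contra.{u, u} R where
  carrier := R
  str := ofSumming (summing_self R)

theorem act_self (a : FormalSum R R) : (self R).act a = ∑' s : R, a.1 s * s := rfl

theorem act_bind {X : Type*} (a : FormalSum R X) (k : X → FormalSum R P) :
    P.act (FormalSum.bind a k) = P.act (FormalSum.map (fun x => P.act (k x)) a) := by
  rw [← FormalSum.join_map, act_join, FormalSum.map_map]; rfl

/-- The isomorphism `Hom^R(R, P) ≅ P` taking a contramodule morphism `g` to `g(1)`. -/
def evalOne (P : Contra.{u, u} R) : (self R ⟶ P) ≃ P where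
  toFun g := Hom.toFun g (1 : R)
  invFun p :=
    { toFun := fun r : R => r • p
      map_act := fun a => by
        refine Eq.trans ?_ (P.act_bind a fun s : R => s • FormalSum.single p)
        change P.act ((∑' s : R, a.1 s * s) • FormalSum.single p) = _
        congr 1
        refine Subtype.ext (funext fun q => ?_)
        change (∑' s : R, a.1 s * s) * (FormalSum.single p).1 q =
          ∑' s : R, a.1 s * (s * (FormalSum.single p).1 q)
        simp only [← mul_assoc]
        exact (((summing_self R).summable ((summing_self R).tendsto a fun s => s)).map_tsum
          (AddMonoidHom.mulRight ((FormalSum.single p).1 q)) (continuous_mul_const _)) }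
  left_inv g := by
    refine Hom.ext (funext fun r : R => ?_)
    have h := Hom.map_act g (r • FormalSum.single (1 : R))
    have h2 : FormalSum.map g.toFun (r • FormalSum.single (1 : R) : FormalSum R R) =
        r • FormalSum.single (Hom.toFun g (1 : R)) :=
      (FormalSum.map_smul (X := R) (Hom.toFun g) r _).trans
        (congrArg _ (FormalSum.map_single (X := R) (Hom.toFun g) (1 : R)))
    replace h := h.trans (congrArg P.act h2)
    refine Eq.trans h.symm (congrArg (Hom.toFun g) ?_)
    change ∑' s : R, (r * (FormalSum.single (1 : R)).1 s) * s = r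
    rw [tsum_eq_single (1 : R) fun s hs => by simp [FormalSum.single, hs]]
    simp [FormalSum.single]
  right_inv p := one_smul R p

variable {M : Type v} [AddCommGroup M] (J : Ideal R) [J.IsTwoSided] [Module (R ⧸ J) M]

theorem finite_support_act (hJ : IsOpen (J : Set R)) (a : FormalSum R M) :
    (Function.support fun m => Ideal.Quotient.mk J (a.1 m) • m).Finite := by
  refine (show {m | a.1 m ∉ J}.Finite from a.2 (hJ.mem_nhds J.zero_mem)).subset ?_
  intro m hm hmJ
  exact hm (by simp only [Ideal.Quotient.eq_zero_iff_mem.2 hmJ, zero_smul])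

variable (M) in
/-- A left module over the discrete quotient ring `R/J`, where `J` is an open two-sided ideal,
viewed as a left `R`-contramodule. The sum in the definition of the contraaction map has only
finitely many nonzero terms. -/
def ofModule (hJ : IsOpen (J : Set R)) : Contra.{u, v} R where
  carrier := M
  str :=
    letI act : FormalSum R M → M := fun a => ∑ᶠ m, Ideal.Quotient.mk J (a.1 m) • m
    letI : Module R M := Module.compHom M (Ideal.Quotient.mk J)
    letI : UniformSpace M := ⊥
    haveI : DiscreteUniformity M := ⟨rfl⟩
    have H : Summing R M :=
      { nonarch := ⟨fun U hU => ⟨⟨⊥, isOpen_discrete _⟩, by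
          rintro _ rfl
          exact mem_of_mem_nhds hU⟩⟩
        unif := fun U hU => ⟨J, hJ.mem_nhds J.zero_mem, fun r hr m => by
          have : r • m = 0 := by
            change Ideal.Quotient.mk J r • m = 0
            rw [Ideal.Quotient.eq_zero_iff_mem.2 hr, zero_smul]
          rw [this]
          exact mem_of_mem_nhds hU⟩
        cont := fun r => continuous_of_discreteTopology }
    have h : act = (ofSumming H).act :=
      funext fun a => (tsum_eq_finsum (finite_support_act J hJ a)).symm
    { act := act
      act_single := by rw [h]; exact (ofSumming H).act_single
      act_join := by rw [h]; exact (ofSumming H).act_join }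

end Contra

/-- The category of separated left `R`-contramodules, a full subcategory of the category of left
`R`-contramodules. -/
abbrev SepContra := (Contra.IsSeparated (R := R) : ObjectProperty (Contra.{u, v} R)).FullSubcategory

end Contra

/-! ### Restriction of scalars, strong right tautness -/

section Change

variable {R S : Type u}
  [Ring R] [UniformSpace R] [IsUniformAddGroup R] [IsTopologicalRing R]
  [Ring S] [UniformSpace S] [IsUniformAddGroup S] [IsTopologicalRing S]

/-- The map `f[[X]] : R[[X]] → S[[X]]`, taking `∑ aₓ x` to `∑ f(aₓ) x`. -/
def FormalSum.mapCoeff {X : Type*} (f : R →+* S) (hf : Continuous f) (a : FormalSum R X) :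
    FormalSum S X :=
  ⟨fun x => f (a.1 x), by
    have := (hf.tendsto 0).comp a.2
    rwa [_root_.map_zero f] at this⟩

/-- A ring map between two-sided linear topological rings is strongly right taut if the open
two-sided ideals `I` of `R` for which the closure of the right ideal `f(I)S` of `S` is an open
two-sided ideal of `S` form a base of neighbourhoods of zero in `R`. -/
def StronglyRightTaut (f : R →+* S) : Prop :=
  ∀ U ∈ 𝓝 (0 : R), ∃ I : Ideal R, I.IsTwoSided ∧ IsOpen (I : Set R) ∧ (I : Set R) ⊆ U ∧
    ∃ J : Ideal S, J.IsTwoSided ∧ IsOpen (J : Set S) ∧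
      (J : Set S) = closure (Submodule.span Sᵐᵒᵖ (f '' (I : Set R)) : Set S)

/-- Descending chains of open two-sided ideals `I₀ ⊇ I₁ ⊇ ⋯` of `R` and `J₀ ⊇ J₁ ⊇ ⋯` of `S`,
forming bases of neighbourhoods of zero, such that `Jₙ` is the closure of the right ideal
`f(Iₙ)S`. -/
structure TautChain (f : R →+* S) where
  I : ℕ → Ideal R
  J : ℕ → Ideal S
  twoSided_I : ∀ n, (I n).IsTwoSided
  twoSided_J : ∀ n, (J n).IsTwoSided
  isOpen_I : ∀ n, IsOpen (I n : Set R)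
  isOpen_J : ∀ n, IsOpen (J n : Set S)
  basis_I : (𝓝 (0 : R)).HasAntitoneBasis fun n => (I n : Set R)
  basis_J : (𝓝 (0 : S)).HasAntitoneBasis fun n => (J n : Set S)
  closure_eq : ∀ n, (J n : Set S) = closure (Submodule.span Sᵐᵒᵖ (f '' (I n : Set R)) : Set S)

attribute [instance] TautChain.twoSided_I TautChain.twoSided_J

namespace TautChain

variable {f : R →+* S} (T : TautChain f)

theorem I_le (n : ℕ) : T.I (n + 1) ≤ T.I n := T.basis_I.antitone n.le_succ

theorem J_le (n : ℕ) : T.J (n + 1) ≤ T.J n := T.basis_J.antitone n.le_succ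

theorem I_le_comap (n : ℕ) : T.I n ≤ (T.J n).comap f := fun r hr => by
  change f r ∈ (T.J n : Set S)
  rw [T.closure_eq n]
  exact subset_closure (Submodule.subset_span ⟨r, hr, rfl⟩)

/-- The ring map `Rₙ → Sₙ` induced by `f`, where `Rₙ = R/Iₙ` and `Sₙ = S/Jₙ`. -/
def quotientMap (n : ℕ) : R ⧸ T.I n →+* S ⧸ T.J n := Ideal.quotientMap (T.J n) f (T.I_le_comap n)

end TautChain

variable [IsLinearTopology Rᵐᵒᵖ R] [CompleteSpace R] [T2Space R]
  [IsLinearTopology Sᵐᵒᵖ S] [CompleteSpace S] [T2Space S]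
  (f : R →+* S) (hf : Continuous f)

namespace FormalSum

variable {X Y : Type*}

theorem mapCoeff_single (x : X) : mapCoeff f hf (single x) = single x := by
  refine Subtype.ext (funext fun y => ?_)
  by_cases h : y = x <;> simp [mapCoeff, single, h]

theorem mapCoeff_bind (a : FormalSum R X) (k : X → FormalSum R Y) :
    mapCoeff f hf (bind a k) = bind (mapCoeff f hf a) fun x => mapCoeff f hf (k x) := by
  refine Subtype.ext (funext fun y => ?_)
  have := ((summing_self R).summable
    ((summing_self R).tendsto a fun x => (k x).1 y)).map_tsum f hf
  simp only [smul_eq_mul, map_mul f] at this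
  exact this

theorem mapCoeff_map (g : X → Y) (a : FormalSum R X) :
    mapCoeff f hf (map g a) = map g (mapCoeff f hf a) := by
  simp only [map_eq_bind, mapCoeff_bind, mapCoeff_single]

theorem mapCoeff_join (z : FormalSum R (FormalSum R X)) :
    mapCoeff f hf (join z) = join (map (mapCoeff f hf) (mapCoeff f hf z)) := by
  rw [join_map, join_eq_bind]
  exact mapCoeff_bind f hf z id

end FormalSum

namespace Contra

/-- The functor of restriction of scalars from left `S`-contramodules to left `R`-contramodules:
the set remains the same, and the contraaction is composed with `f[[Q]] : R[[Q]] → S[[Q]]`. -/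
def restrictScalars : Contra.{u, v} S ⥤ Contra.{u, v} R where
  obj Q :=
    { carrier := Q
      str :=
        { act := fun a => Q.act (FormalSum.mapCoeff f hf a)
          act_single := fun q => by rw [FormalSum.mapCoeff_single, act_single]
          act_join := fun z => by
            rw [FormalSum.mapCoeff_join, act_join, FormalSum.map_map]
            exact congrArg Q.act (FormalSum.mapCoeff_map f hf _ z).symm } }
  map g := ⟨g.toFun, fun a => by
    refine (g.map_act _).trans ?_
    rw [← FormalSum.mapCoeff_map]
    rfl⟩

theorem restrictScalars_separated {Q : Contra.{u, v} S} (hQ : IsSeparated Q) :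
    IsSeparated ((restrictScalars f hf).obj Q) := by
  intro q hq
  have h0 : (0 : (restrictScalars f hf).obj Q) = (0 : Q) := by
    change Q.act (FormalSum.mapCoeff f hf 0) = Q.act 0
    congr 1
    exact Subtype.ext (funext fun x => map_zero f)
  rw [h0]
  refine hQ q fun J hJ => ?_
  let I : Submodule Rᵐᵒᵖ R :=
    { carrier := f ⁻¹' (J : Set S)
      zero_mem' := by simp
      add_mem' := fun {a b} ha hb => by
        rw [Set.mem_preimage, map_add f]
        exact J.add_mem ha hb
      smul_mem' := fun c x hx => by
        rw [Set.mem_preimage, ← op_unop c, op_smul_eq_mul, map_mul f]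
        exact J.smul_mem (op (f c.unop)) hx }
  obtain ⟨a, ha, rfl⟩ := hq I (hJ.preimage hf)
  exact ⟨FormalSum.mapCoeff f hf a, ha, rfl⟩

end Contra

/-- The functor of restriction of scalars from separated left `S`-contramodules to separated left
`R`-contramodules. -/
def SepContra.restrictScalars : SepContra.{u, v} S ⥤ SepContra.{u, v} R :=
  ObjectProperty.lift _ (ObjectProperty.ι _ ⋙ Contra.restrictScalars f hf)
    fun Q => Contra.restrictScalars_separated f hf Q.property

/-- The ring map `f : R → S` as a morphism of left `R`-contramodules. -/
def Contra.selfMap : Contra.self R ⟶ (Contra.restrictScalars f hf).obj (Contra.self S) where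
  toFun := f
  map_act (a : FormalSum R R) := by
    change f (∑' s : R, a.1 s * s) =
      ∑' t : S, (FormalSum.mapCoeff f hf (FormalSum.map (Y := S) f a)).1 t * t
    rw [FormalSum.mapCoeff_map, FormalSum.map_eq_bind]
    refine Eq.trans ?_ (FormalSum.tsum_bind (summing_self S) (FormalSum.mapCoeff f hf a)
      (fun s : R => FormalSum.single (f s)) id).symm
    have h := ((summing_self R).summable
      ((summing_self R).tendsto a fun s => s)).map_tsum f hf
    simp only [smul_eq_mul, map_mul f] at h
    exact h.trans (tsum_congr fun s => congrArg _ (FormalSum.tsum_single (f s) id).symm)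

/-- The set `Hom^R(S, P)` of left `R`-contramodule morphisms from `S` to `P`. -/
abbrev HomFrom (P : Contra.{u, u} R) : Type u :=
  (Contra.restrictScalars f hf).obj (Contra.self S) ⟶ P

/-- The value at `s ∈ S` of an element of `Hom^R(S, P)`. -/
def HomFrom.eval {f : R →+* S} {hf : Continuous f} {P : Contra.{u, u} R}
    (h : HomFrom f hf P) (s : S) : P := Contra.Hom.toFun h s

/-- A choice of separated left `S`-contramodule structures on the sets `Hom^R(S, P)`, for all
separated left `R`-contramodules `P`, such that for every morphism `P → P'` the composition map
`Hom^R(S, P) → Hom^R(S, P')` is a morphism of `S`-contramodules. -/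
structure CoextensionStructure where
  str : ∀ P : SepContra.{u, u} R, ContraStr S (HomFrom f hf P.obj)
  separated : ∀ P, Contra.IsSeparated (⟨_, str P⟩ : Contra.{u, u} S)
  natural : ∀ {P P' : SepContra.{u, u} R} (g : P ⟶ P') (a : FormalSum S (HomFrom f hf P.obj)),
    (str P).act a ≫ g.hom = (str P').act (FormalSum.map (fun h => h ≫ g.hom) a)

namespace CoextensionStructure

variable {f hf}

/-- The functor `P ↦ Hom^R(S, P)` from separated left `R`-contramodules to separated left
`S`-contramodules defined by a choice of contramodule structures. -/
def functor (C : CoextensionStructure f hf) : SepContra.{u, u} R ⥤ SepContra.{u, u} S where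
  obj P := ⟨⟨HomFrom f hf P.obj, C.str P⟩, C.separated P⟩
  map g := ⟨⟨fun h => h ≫ g.hom, C.natural g⟩⟩

end CoextensionStructure

/-- The left `Sₙ`-module `Hom_{Rₙ}(Sₙ, Pₙ)`, where `Pₙ = P/(Iₙ ⋌ P)`. -/
abbrev TautChain.homModule {f : R →+* S} (T : TautChain f) (P : Contra.{u, u} R) (n : ℕ) :
    ModuleCat.{u} (S ⧸ T.J n) :=
  (ModuleCat.coextendScalars (T.quotientMap n)).obj
    (ModuleCat.of (R ⧸ T.I n) (P ⧸ P.timSubmodule (T.I n)))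

/-- The value at `x ∈ Sₙ` of an element of `Hom_{Rₙ}(Sₙ, Pₙ)`. -/
def TautChain.homModule.eval {f : R →+* S} {T : TautChain f} {P : Contra.{u, u} R} {n : ℕ}
    (g : T.homModule P n) (x : S ⧸ T.J n) : P ⧸ P.timSubmodule (T.I n) :=
  ModuleCat.CoextendScalars.equiv _ _ g x

/-- The left `Sₙ`-module `Hom_{Rₙ}(Sₙ, Pₙ)`, viewed as a left `S`-contramodule. -/
abbrev TautChain.homContra {f : R →+* S} (T : TautChain f) (P : Contra.{u, u} R) (n : ℕ) :
    Contra.{u, u} S :=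
  Contra.ofModule (T.homModule P n) (T.J n) (T.isOpen_J n)

/-- The transition map of the projective system `(Hom_{Rₙ}(Sₙ, Pₙ))ₙ` takes `g'` to `g`: the
maps `g' : Sₙ₊₁ → Pₙ₊₁` and `g : Sₙ → Pₙ` form a commutative square with the natural surjections
`Sₙ₊₁ → Sₙ` and `Pₙ₊₁ → Pₙ`. -/
def TautChain.Compatible {f : R →+* S} (T : TautChain f) (P : Contra.{u, u} R) (n : ℕ)
    (g' : T.homModule P (n + 1)) (g : T.homModule P n) : Prop :=
  ∀ x : S ⧸ T.J (n + 1), Submodule.factor (P.timSubmodule_mono (T.I_le n)) (homModule.eval g' x) =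
    homModule.eval g (Ideal.Quotient.factor (T.J_le n) x)

end Change

end Contramodules

end

noncomputable section

namespace Contramodules

/-! ### Complete filtered abelian groups -/

/-! The crux is the equality `Jₙ ⋌ Q = Iₙ ⋌ Q` for every separated left `S`-contramodule `Q`
(`TautChain.mem_restrict_timSubmodule`), where the right-hand side is formed over `R`. Since `Jₙ` is
the closure of `f(Iₙ)S`, every element of `Jₙ` agrees modulo `Jₙ₊₁` with an element of `f(Iₙ)S`, so
`Jₙ ⋌ Q` lies in `Iₙ ⋌ Q + Jₙ₊₁ ⋌ Q`. Iterating and summing the resulting series of formal sums,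
whose coefficients lie in smaller and smaller ideals, removes the error term; separatedness of `Q`
shows that nothing is left over.

Applied to `Q = S`, the equality says that a contramodule morphism `S → P` carries `Jₙ` into `Iₙ ⋌
P` (`HomFrom.eval_mem`). Conversely, an `R`-linear map with this property is a contramodule morphism
when `P` is separated: modulo `Iₙ ⋌ P` only finitely many coefficients of a formal sum matter, so
linearity suffices (`Contra.map_act_sub_mem`). Hence `Hom^R(S, P)` is closed under pointwise limits
and is separated and complete for the filtration by the morphisms with values in `Iₙ ⋌ P`. As
`(sg)(t) = g(ts)` and `Jₙ` is a left ideal, `Jₙ` maps the whole of `Hom^R(S, P)` into the `n`-th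
step, so zero-convergent combinations converge there, and their sums define the contramodule
structure.

The same approximation principle shows that all the maps involved respect contraactions: reduction
to `Hom_{Rₙ}(Sₙ, Pₙ)`, composition with `P → P'`, the unit `q ↦ (s ↦ sq)` and the counit `h ↦ h(1)`.
The limit description follows from completeness and separatedness of `P`, and the triangle
identities reduce to `1q = q` and `(th)(1) = h(t)`. -/

/-- A descending filtration of an abelian group by subgroups, with respect to which the group is
separated and complete. -/
structure CompleteFiltration (M : Type v) [AddCommGroup M] where
  sub : ℕ → AddSubgroup M
  antitone : Antitone sub
  eq_zero : ∀ x, (∀ n, x ∈ sub n) → x = 0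
  exists_limit : ∀ x : ℕ → M, (∀ n, x (n + 1) - x n ∈ sub n) → ∃ y, ∀ n, y - x n ∈ sub n

namespace CompleteFiltration

section Topology

variable {M : Type v} [AddCommGroup M] (Φ : CompleteFiltration M)

/-- The members of the filtration as a filter basis. -/
@[reducible]
def filterBasis : AddGroupFilterBasis M :=
  addGroupFilterBasisOfComm (Set.range fun n => (Φ.sub n : Set M)) ⟨_, 0, rfl⟩
    (by
      rintro _ _ ⟨m, rfl⟩ ⟨n, rfl⟩
      exact ⟨_, ⟨max m n, rfl⟩, Set.subset_inter (Φ.antitone (le_max_left m n))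
        (Φ.antitone (le_max_right m n))⟩)
    (by rintro _ ⟨n, rfl⟩; exact (Φ.sub n).zero_mem)
    (by
      rintro _ ⟨n, rfl⟩
      refine ⟨_, ⟨n, rfl⟩, ?_⟩
      rintro _ ⟨a, ha, b, hb, rfl⟩
      exact (Φ.sub n).add_mem ha hb)
    (by
      rintro _ ⟨n, rfl⟩
      exact ⟨_, ⟨n, rfl⟩, fun a ha => (Φ.sub n).neg_mem ha⟩)

/-- The uniform structure for which the members of the filtration form a base of neighbourhoods
of zero. -/
@[reducible]
def uniformSpace : UniformSpace M :=
  letI := Φ.filterBasis.topology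
  IsTopologicalAddGroup.rightUniformSpace M

theorem isUniformAddGroup : @IsUniformAddGroup M Φ.uniformSpace _ :=
  letI := Φ.filterBasis.topology
  isUniformAddGroup_of_addCommGroup

theorem mem_nhds_zero {U : Set M} :
    U ∈ @nhds M Φ.uniformSpace.toTopologicalSpace 0 ↔ ∃ n, (Φ.sub n : Set M) ⊆ U := by
  refine (Φ.filterBasis.nhds_zero_hasBasis.mem_iff).trans ?_
  constructor
  · rintro ⟨_, ⟨n, rfl⟩, h⟩
    exact ⟨n, h⟩
  · rintro ⟨n, h⟩
    exact ⟨_, ⟨n, rfl⟩, h⟩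

theorem isOpen_of_le {G : AddSubgroup M} {n : ℕ} (h : Φ.sub n ≤ G) :
    @IsOpen M Φ.uniformSpace.toTopologicalSpace (G : Set M) := by
  letI := Φ.uniformSpace
  haveI := Φ.isUniformAddGroup
  exact G.isOpen_of_mem_nhds (Φ.mem_nhds_zero.2 ⟨n, h⟩)

theorem t2Space : @T2Space M Φ.uniformSpace.toTopologicalSpace := by
  letI := Φ.uniformSpace
  haveI := Φ.isUniformAddGroup
  refine IsTopologicalAddGroup.t2Space_of_zero_sep fun x hx => ?_
  by_contra! h
  exact hx (Φ.eq_zero x fun n => h _ (Φ.mem_nhds_zero.2 ⟨n, subset_rfl⟩))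

/-- The uniformity is countably generated, so Cauchy sequences suffice. A subsequence whose
consecutive differences lie in successive steps of the filtration has a limit by hypothesis, and
this is then a limit of the whole sequence. -/
theorem completeSpace : @CompleteSpace M Φ.uniformSpace := by
  letI := Φ.uniformSpace
  haveI := Φ.isUniformAddGroup
  have hb : (𝓝 (0 : M)).HasAntitoneBasis fun n => (Φ.sub n : Set M) :=
    ⟨⟨fun U => by simpa using Φ.mem_nhds_zero⟩, Φ.antitone⟩
  haveI := hb.1.isCountablyGenerated
  haveI := IsUniformAddGroup.uniformity_countably_generated (α := M)
  refine UniformSpace.complete_of_cauchySeq_tendsto fun x hx => ?_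
  have hV : ∀ n, {p : M × M | p.2 - p.1 ∈ Φ.sub n} ∈ uniformity M := fun n => by
    rw [uniformity_eq_comap_nhds_zero]
    exact preimage_mem_comap (hb.1.mem_of_mem trivial)
  obtain ⟨φ, hφ, h⟩ := hx.subseq_mem hV
  obtain ⟨y, hy⟩ := Φ.exists_limit (x ∘ φ) fun n => by
    have := (Φ.sub n).neg_mem (h n)
    simpa using this
  refine ⟨y, tendsto_nhds_of_cauchySeq_of_subseq hx hφ.tendsto_atTop ?_⟩
  rw [← tendsto_sub_nhds_zero_iff, hb.1.tendsto_right_iff]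
  intro n _
  filter_upwards [eventually_ge_atTop n] with k hk
  have := (Φ.sub n).neg_mem (Φ.antitone hk (hy k))
  simpa using this

end Topology

section ContraStr

variable {R : Type u} [Ring R] [UniformSpace R] [IsUniformAddGroup R] [IsTopologicalRing R]
  [IsLinearTopology Rᵐᵒᵖ R] [CompleteSpace R] [T2Space R]
  {M : Type v} [AddCommGroup M] [Module R M] (Φ : CompleteFiltration M)

/-- The first hypothesis makes each scalar act continuously; the second makes `r • m` small
uniformly in `m` once `r` is small, which forces `∑ rₘ m` to converge for zero-convergent
coefficients. -/
theorem summing (h : ∀ (r : R) n, ∀ m ∈ Φ.sub n, r • m ∈ Φ.sub n)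
    (hU : ∀ n, ∃ V ∈ 𝓝 (0 : R), ∀ r ∈ V, ∀ m : M, r • m ∈ Φ.sub n) :
    @Summing R _ _ M _ _ Φ.uniformSpace := by
  letI := Φ.uniformSpace
  haveI := Φ.isUniformAddGroup
  refine ⟨⟨fun U hU => ?_⟩, fun U hU' => ?_, fun r => ?_⟩
  · obtain ⟨n, hn⟩ := Φ.mem_nhds_zero.1 hU
    exact ⟨⟨Φ.sub n, Φ.isOpen_of_le le_rfl⟩, hn⟩
  · obtain ⟨n, hn⟩ := Φ.mem_nhds_zero.1 hU'
    obtain ⟨V, hV, H⟩ := hU n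
    exact ⟨V, hV, fun r hr m => hn (H r hr m)⟩
  · refine continuous_of_continuousAt_zero (DistribSMul.toAddMonoidHom M r) fun U hU => ?_
    rw [map_zero] at hU
    obtain ⟨n, hn⟩ := Φ.mem_nhds_zero.1 hU
    exact Φ.mem_nhds_zero.2 ⟨n, fun m hm => hn (h r n m hm)⟩

/-- The contramodule structure on a complete filtered module, given by infinite sums. -/
def contraStr (H : @Summing R _ _ M _ _ Φ.uniformSpace) : ContraStr R M :=
  letI := Φ.uniformSpace
  haveI := Φ.isUniformAddGroup
  haveI := Φ.completeSpace
  haveI := Φ.t2Space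
  Contra.ofSumming H

variable {Φ} (H : @Summing R _ _ M _ _ Φ.uniformSpace)

/-- A subgroup containing a step of the filtration is open, hence closed, so it contains the limits
of the partial sums that it contains. -/
theorem contraStr_act_mem {G : AddSubgroup M} {n : ℕ} (hG : Φ.sub n ≤ G) (a : FormalSum R M)
    (ha : ∀ m, a.1 m • m ∈ G) : (Φ.contraStr H).act a ∈ G := by
  letI := Φ.uniformSpace
  haveI := Φ.isUniformAddGroup
  haveI := Φ.completeSpace
  haveI := Φ.t2Space
  have hc : IsClosed (G : Set M) :=
    AddSubgroup.isClosed_of_isOpen G (Φ.isOpen_of_le hG)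
  exact hc.mem_of_tendsto (H.summable (H.tendsto a id)).hasSum
    (Eventually.of_forall fun s => sum_mem fun m _ => ha m)

theorem contraStr_act_add (a b : FormalSum R M) :
    (Φ.contraStr H).act (a + b) = (Φ.contraStr H).act a + (Φ.contraStr H).act b := by
  letI := Φ.uniformSpace
  haveI := Φ.isUniformAddGroup
  haveI := Φ.completeSpace
  haveI := Φ.t2Space
  change ∑' m, (a.1 m + b.1 m) • m = _
  simp only [add_smul]
  exact (H.summable (H.tendsto a id)).tsum_add (H.summable (H.tendsto b id))

theorem contraStr_act_smul_single (r : R) (m : M) :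
    (Φ.contraStr H).act (r • FormalSum.single m) = r • m := by
  letI := Φ.uniformSpace
  haveI := Φ.isUniformAddGroup
  haveI := Φ.completeSpace
  haveI := Φ.t2Space
  change ∑' x, (r * (FormalSum.single m).1 x) • x = _
  rw [tsum_eq_single m fun y hy => by simp [FormalSum.single, hy]]
  simp [FormalSum.single]

theorem contraStr_act_single_add_single (m m' : M) :
    (Φ.contraStr H).act (FormalSum.single m + FormalSum.single m') = m + m' := by
  rw [contraStr_act_add, (Φ.contraStr H).act_single, (Φ.contraStr H).act_single]

end ContraStr

end CompleteFiltration

/-! ### Convergence of series in contramodules -/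

section Series

variable {R : Type u} [Ring R] [UniformSpace R] [IsUniformAddGroup R] [IsTopologicalRing R]
  [IsLinearTopology Rᵐᵒᵖ R] [CompleteSpace R] [T2Space R] {X Y : Type*}

theorem isClosed_of_isOpen_ideal {I : Ideal R} (hI : IsOpen (I : Set R)) :
    IsClosed (I : Set R) :=
  AddSubgroup.isClosed_of_isOpen I.toAddSubgroup hI

theorem tsum_mem_of_isOpen_ideal {I : Ideal R} (hI : IsOpen (I : Set R)) {x : X → R}
    (hx : ∀ i, x i ∈ I) : ∑' i, x i ∈ I := by
  by_cases h : Summable x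
  · exact (isClosed_of_isOpen_ideal hI).mem_of_tendsto h.hasSum
      (Eventually.of_forall fun s => sum_mem fun i _ => hx i)
  · rw [tsum_eq_zero_of_not_summable h]
    exact I.zero_mem

namespace FormalSum

theorem sum_apply {ι : Type*} (s : Finset ι) (a : ι → FormalSum R X) (x : X) :
    (∑ i ∈ s, a i).1 x = ∑ i ∈ s, (a i).1 x := by
  rw [AddSubgroup.val_finsetSum, Finset.sum_apply]

theorem map_apply_mem {I : Ideal R} (hI : IsOpen (I : Set R)) (g : X → Y) {a : FormalSum R X}
    (ha : ∀ x, a.1 x ∈ I) (y : Y) : (map g a).1 y ∈ I :=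
  tsum_mem_of_isOpen_ideal hI fun x : {x // g x = y} => ha x

/-- Zero-convergence leaves only finitely many coefficients outside `I`; the finite set consists of
their indices. This reduces statements about formal sums to finite ones, modulo coefficients in `I`.
-/
theorem exists_finset_sub_mem {I : Ideal R} (hI : IsOpen (I : Set R)) (a : FormalSum R X) :
    ∃ s : Finset X, ∀ x, (a - ∑ y ∈ s, a.1 y • single y).1 x ∈ I := by
  classical
  have hfin : {x | a.1 x ∉ I}.Finite := a.2 (hI.mem_nhds I.zero_mem)
  refine ⟨hfin.toFinset, fun x => ?_⟩
  change a.1 x - (∑ y ∈ hfin.toFinset, a.1 y • single y).1 x ∈ I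
  have : (∑ y ∈ hfin.toFinset, a.1 y • single (R := R) y).1 x =
      if x ∈ hfin.toFinset then a.1 x else 0 := by
    rw [sum_apply]
    simp only [smul_apply, single, mul_ite, mul_one, mul_zero]
    exact Finset.sum_ite_eq hfin.toFinset x a.1
  rw [this]
  split_ifs with h
  · simp
  · simpa using h

/-- A series of formal sums whose coefficients belong to smaller and smaller ideals converges. -/
theorem exists_series {I : ℕ → Ideal R} (hI : ∀ n, IsOpen (I n : Set R))
    (hb : (𝓝 (0 : R)).HasAntitoneBasis fun n => (I n : Set R))
    (a : ℕ → FormalSum R X) (ha : ∀ n x, (a n).1 x ∈ I n) :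
    ∃ b : FormalSum R X, ∀ n x, (b - ∑ k ∈ Finset.range n, a k).1 x ∈ I n := by
  have hs : ∀ x, Summable fun n => (a n).1 x := fun x => by
    refine (summing_self R).summable ?_
    rw [Nat.cofinite_eq_atTop, hb.1.tendsto_right_iff]
    intro n _
    filter_upwards [eventually_ge_atTop n] with k hk
    exact hb.antitone hk (ha k x)
  have htail : ∀ n x, ∑' k, (a k).1 x - ∑ k ∈ Finset.range n, (a k).1 x ∈ I n := fun n x => by
    rw [← (hs x).sum_add_tsum_nat_add n, add_sub_cancel_left]
    exact tsum_mem_of_isOpen_ideal (hI n) fun k => hb.antitone (Nat.le_add_left n k) (ha _ x)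
  refine ⟨⟨fun x => ∑' n, (a n).1 x, ?_⟩, fun n x => ?_⟩
  · change Tendsto _ _ _
    rw [hb.1.tendsto_right_iff]
    intro n _
    -- Modulo `I n` the sum of the series agrees with its first `n` terms, so it inherits
    -- zero-convergence from a finite sum.
    have : ∀ k ∈ Finset.range n, ∀ᶠ x in cofinite, (a k).1 x ∈ I n := fun k _ =>
      (a k).2 ((hI n).mem_nhds (I n).zero_mem)
    filter_upwards [(eventually_all_finset _).2 this] with x hx
    exact (Submodule.sub_mem_iff_left _ ((I n).sum_mem fun k hk => hx k hk)).1 (htail n x)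
  · change ∑' k, (a k).1 x - (∑ k ∈ Finset.range n, a k).1 x ∈ I n
    rw [sum_apply]
    exact htail n x

end FormalSum

namespace Contra

variable (P : Contra.{u, v} R)

/-- The contraaction map as an additive map. -/
def actHom : FormalSum R P →+ P := AddMonoidHom.mk' P.act P.act_add

theorem actHom_apply (a : FormalSum R P) : P.actHom a = P.act a := rfl

theorem act_mem_timSubmodule {I : Ideal R} {a : FormalSum R P} (ha : ∀ x, a.1 x ∈ I) :
    P.act a ∈ P.timSubmodule I := ⟨a, ha, rfl⟩

-- Separatedness is tested on all open right ideals, but each of them contains some `I n`.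
variable {P} in
theorem IsSeparated.eq_zero (hP : IsSeparated P) {I : ℕ → Ideal R}
    (hb : (𝓝 (0 : R)).HasAntitoneBasis fun n => (I n : Set R)) {p : P}
    (hp : ∀ n, p ∈ P.timSubmodule (I n)) : p = 0 := by
  refine hP p fun K hK => ?_
  obtain ⟨n, -, hn⟩ := hb.1.mem_iff.1 (hK.mem_nhds K.zero_mem)
  obtain ⟨a, ha, rfl⟩ := hp n
  exact ⟨a, fun x => hn (ha x), rfl⟩

/-- Completeness of every contramodule, separated or not: the differences lift to formal sums with
coefficients in `I n`, these can be summed before applying the contraaction, and the partial sums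
telescope. The limit need not be unique. -/
theorem exists_limit {I : ℕ → Ideal R} (hI : ∀ n, IsOpen (I n : Set R))
    (hb : (𝓝 (0 : R)).HasAntitoneBasis fun n => (I n : Set R)) (p : ℕ → P)
    (hp : ∀ n, p (n + 1) - p n ∈ P.timSubmodule (I n)) :
    ∃ q : P, ∀ n, q - p n ∈ P.timSubmodule (I n) := by
  choose a ha hap using hp
  obtain ⟨b, hbs⟩ := FormalSum.exists_series hI hb a ha
  refine ⟨P.act b + p 0, fun n => ⟨_, hbs n, ?_⟩⟩
  rw [← actHom_apply, map_sub, map_sum]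
  simp only [actHom_apply]
  rw [Finset.sum_congr rfl fun k _ => hap k, Finset.sum_range_sub]
  abel

/-- A module map compatible with the subgroups `I ⋌ M` and `I ⋌ N` commutes with the contraaction
maps up to elements of `I ⋌ N`. -/
theorem map_act_sub_mem {M : Contra.{u, v} R} {N : Contra R} (g : M → N)
    (hadd : ∀ x y, g (x + y) = g x + g y) (hsmul : ∀ (r : R) x, g (r • x) = r • g x)
    {I : Ideal R} (hI : IsOpen (I : Set R)) (N' : AddSubgroup N)
    (hN : ∀ x ∈ N.timSubmodule I, x ∈ N') (hM : ∀ x ∈ M.timSubmodule I, g x ∈ N')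
    (a : FormalSum R M) : g (M.act a) - N.act (FormalSum.map g a) ∈ N' := by
  obtain ⟨s, hs⟩ := FormalSum.exists_finset_sub_mem hI a
  -- The defect `φ` is additive and vanishes on single terms by linearity of `g`, hence on the
  -- finite part of `a`. On the remainder, with coefficients in `I`, both of its terms lie in `N'`.
  let φ : FormalSum R M →+ N :=
    AddMonoidHom.mk' (fun a => g (M.act a) - N.act (FormalSum.map g a)) fun a b => by
      rw [M.act_add, hadd, FormalSum.map_add, N.act_add]
      abel
  have h0 : ∀ (r : R) (m : M), φ (r • FormalSum.single m) = 0 := fun r m => by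
    change g (r • m) - N.act (FormalSum.map g (r • FormalSum.single m)) = 0
    rw [FormalSum.map_smul, FormalSum.map_single, hsmul]
    exact sub_self _
  have h1 : φ (a - ∑ y ∈ s, a.1 y • FormalSum.single y) ∈ N' :=
    N'.sub_mem (hM _ (M.act_mem_timSubmodule hs))
      (hN _ (N.act_mem_timSubmodule (FormalSum.map_apply_mem hI g hs)))
  rw [map_sub, map_sum, Finset.sum_eq_zero fun m _ => h0 _ m, sub_zero] at h1
  exact h1

/-- The operations of `self R` are by definition values of the contraaction, that is, infinite sums
in `R`; this and the next two lemmas identify them with the ring operations. -/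
theorem self_zero : (0 : self R) = (0 : R) := by
  change ∑' s : R, (0 : R) * s = 0
  simp

theorem self_add (x y : self R) : x + y = (show R from x) + (show R from y) := by
  change ∑' s : R, ((FormalSum.single (R := R) x).1 s + (FormalSum.single (R := R) y).1 s) * s =
    (show R from x) + (show R from y)
  simp only [add_mul]
  refine (((summing_self R).summable ((summing_self R).tendsto _ id)).tsum_add
    ((summing_self R).summable ((summing_self R).tendsto _ id))).trans ?_
  exact congrArg₂ _ (FormalSum.tsum_single (R := R) (X := R) x id)
    (FormalSum.tsum_single (R := R) (X := R) y id)

theorem self_smul (r : R) (x : self R) : r • x = r * (show R from x) := by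
  change ∑' s : R, (r * (FormalSum.single (R := R) x).1 s) * s = _
  simp only [mul_assoc]
  refine (((summing_self R).summable ((summing_self R).tendsto _ id)).map_tsum
    (AddMonoidHom.mulLeft r) (continuous_const_mul r)).symm.trans ?_
  exact congrArg (r * ·) (FormalSum.tsum_single (R := R) (X := R) x id)

theorem mem_timSubmodule_self {I : Ideal R} [I.IsTwoSided] (hI : IsOpen (I : Set R)) {x : R} :
    (show self R from x) ∈ (self R).timSubmodule I ↔ x ∈ I := by
  constructor
  · rintro ⟨a, ha, h⟩
    rw [← show ∑' s : R, a.1 s * s = x from h]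
    exact tsum_mem_of_isOpen_ideal hI fun s => I.mul_mem_right _ (ha s)
  · intro hx
    have := (self R).smul_mem_tim hx (show self R from (1 : R))
    rwa [self_smul, show x * (show R from (1 : R)) = x from mul_one x] at this

/-- An open right ideal `K` contains every term `aₛ s` with `aₛ ∈ K` and is closed, so `K ⋌ R ⊆ K`.
In a Hausdorff ring such `K` separate zero from any other point. -/
theorem isSeparated_self : IsSeparated (self R) := by
  intro (x : R) hx
  rw [self_zero]
  by_contra h
  have h' : (0 : R) ≠ x := fun e => h e.symm
  obtain ⟨K, hK, hKx⟩ := (IsLinearTopology.hasBasis_open_submodule Rᵐᵒᵖ).mem_iff.1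
    (isOpen_compl_singleton.mem_nhds h')
  obtain ⟨a, ha, hax⟩ := hx K hK
  refine hKx ?_ (Set.mem_singleton x)
  rw [← show ∑' s : R, a.1 s * s = x from hax]
  have hc : IsClosed (K : Set R) := AddSubgroup.isClosed_of_isOpen K.toAddSubgroup hK
  exact hc.mem_of_tendsto
    ((summing_self R).summable ((summing_self R).tendsto a id)).hasSum
    (Eventually.of_forall fun s => sum_mem fun r _ => K.smul_mem (op r) (ha r))

end Contra

end Series

/-! ### Taut chains and restriction of scalars -/

section Taut

variable {R S : Type u}
  [Ring R] [UniformSpace R] [IsUniformAddGroup R] [IsTopologicalRing R]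
  [Ring S] [UniformSpace S] [IsUniformAddGroup S] [IsTopologicalRing S]

theorem TautChain.nonempty [IsLinearTopology Sᵐᵒᵖ S] [IsLinearTopology S S]
    [(𝓝 (0 : R)).IsCountablyGenerated]
    {f : R →+* S} (hf : Continuous f) (hft : StronglyRightTaut f) : Nonempty (TautChain f) := by
  obtain ⟨U, hU⟩ := (𝓝 (0 : R)).exists_antitone_basis
  choose! I hI hIo hIU J hJ hJo hIJ using hft
  -- The neighbourhoods shrink inside the previously chosen ideal, `Vₙ₊₁ = I(Vₙ) ∩ Uₙ₊₁`, so that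
  -- the ideals `I(Vₙ)` descend and still form a base.
  let V : ℕ → Set R := fun n => Nat.rec (U 0) (fun n W => (I W : Set R) ∩ U (n + 1)) n
  have hV : ∀ n, V n ∈ 𝓝 (0 : R) := fun n => by
    induction n with
    | zero => exact hU.1.mem_of_mem trivial
    | succ n ih => exact inter_mem ((hIo _ ih).mem_nhds (I (V n)).zero_mem) (hU.1.mem_of_mem trivial)
  have hVU : ∀ n, V n ⊆ U n := fun n => by
    cases n with
    | zero => exact subset_rfl
    | succ n => exact Set.inter_subset_right
  have hanti : Antitone fun n => I (V n) := antitone_nat_of_succ_le fun n =>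
    (hIU _ (hV (n + 1))).trans Set.inter_subset_left
  have hbI : (𝓝 (0 : R)).HasBasis (fun _ => True) fun n => (I (V n) : Set R) :=
    hU.1.to_hasBasis (fun n _ => ⟨n, trivial, (hIU _ (hV n)).trans (hVU n)⟩)
      fun n _ => hU.1.mem_iff.1 ((hIo _ (hV n)).mem_nhds (I (V n)).zero_mem)
  refine ⟨⟨fun n => I (V n), fun n => J (V n), fun n => hI _ (hV n), fun n => hJ _ (hV n),
    fun n => hIo _ (hV n), fun n => hJo _ (hV n), ⟨hbI, hanti⟩, ⟨⟨fun W => ⟨fun hW => ?_, ?_⟩⟩, ?_⟩,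
    fun n => hIJ _ (hV n)⟩⟩
  · obtain ⟨N, hN, hNW⟩ := (IsLinearTopology.hasBasis_open_submodule Sᵐᵒᵖ).mem_iff.1 hW
    -- An open right ideal `N` is closed, so once `f(Iₙ) ⊆ N` it also contains the closure of
    -- `f(Iₙ)S`. Thus the `Jₙ` form a base by continuity of `f`.
    have hfN : f ⁻¹' (N : Set S) ∈ 𝓝 (0 : R) :=
      (hN.preimage hf).mem_nhds (by simp)
    obtain ⟨n, -, hn⟩ := hbI.mem_iff.1 hfN
    refine ⟨n, trivial, ?_⟩
    rw [hIJ _ (hV n)]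
    refine (closure_minimal ?_ (AddSubgroup.isClosed_of_isOpen N.toAddSubgroup hN)).trans hNW
    exact Submodule.span_le.2 (Set.image_subset_iff.2 hn)
  · rintro ⟨n, -, hn⟩
    exact mem_of_superset ((hJo _ (hV n)).mem_nhds (J (V n)).zero_mem) hn
  · intro m n hmn
    change (J (V n) : Set S) ⊆ J (V m)
    rw [hIJ _ (hV n), hIJ _ (hV m)]
    exact closure_mono (Submodule.span_mono (Set.image_mono (hanti hmn)))

variable [IsLinearTopology Rᵐᵒᵖ R] [CompleteSpace R] [T2Space R]
  [IsLinearTopology Sᵐᵒᵖ S] [CompleteSpace S] [T2Space S]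
  (f : R →+* S) (hf : Continuous f)

namespace FormalSum

variable {X : Type*}

theorem mapCoeff_add (a b : FormalSum R X) :
    mapCoeff f hf (a + b) = mapCoeff f hf a + mapCoeff f hf b :=
  Subtype.ext (funext fun x => _root_.map_add f (a.1 x) (b.1 x))

theorem mapCoeff_smul (r : R) (a : FormalSum R X) :
    mapCoeff f hf (r • a) = f r • mapCoeff f hf a :=
  Subtype.ext (funext fun x => _root_.map_mul f r (a.1 x))

end FormalSum

namespace Contra

variable (Q : Contra.{u, v} S)

/-- The underlying abelian group does not change under restriction of scalars. -/
def restrictEquiv : Q ≃+ (restrictScalars f hf).obj Q where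
  toFun q := q
  invFun q := q
  map_add' p q := by
    refine congrArg Q.act (Eq.symm ?_)
    refine (FormalSum.mapCoeff_add (X := Q) f hf (FormalSum.single p) (FormalSum.single q)).trans ?_
    rw [FormalSum.mapCoeff_single, FormalSum.mapCoeff_single]

theorem restrictEquiv_smul (r : R) (q : Q) :
    restrictEquiv f hf Q (f r • q) = r • restrictEquiv f hf Q q := by
  refine congrArg Q.act (Eq.symm ?_)
  refine (FormalSum.mapCoeff_smul (X := Q) f hf r (FormalSum.single q)).trans ?_
  rw [FormalSum.mapCoeff_single]

end Contra

namespace TautChain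

variable {f} (T : TautChain f)

theorem restrict_timSubmodule_le (Q : Contra.{u, v} S) {n : ℕ} {q : Q}
    (hq : Contra.restrictEquiv f hf Q q ∈
      ((Contra.restrictScalars f hf).obj Q).timSubmodule (T.I n)) :
    q ∈ Q.timSubmodule (T.J n) := by
  obtain ⟨a, ha, h⟩ := hq
  exact ⟨FormalSum.mapCoeff f hf a, fun x => T.I_le_comap n (ha x), h⟩

/-- One step of successive approximation: `Jₙ ⋌ Q ⊆ Iₙ ⋌ Q + Jₙ₊₁ ⋌ Q`. Elements of `Jₙ` are
congruent modulo `Jₙ₊₁` to elements of `f(Iₙ)S`, and `f(r)t • x = r • (t • x)` lies in `Iₙ ⋌ Q`. -/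
theorem exists_sub_mem (Q : Contra.{u, v} S) {n : ℕ} {q : Q} (hq : q ∈ Q.timSubmodule (T.J n)) :
    ∃ a : FormalSum R Q, (∀ x, a.1 x ∈ T.I n) ∧
      q - Q.act (FormalSum.mapCoeff f hf a) ∈ Q.timSubmodule (T.J (n + 1)) := by
  let E : AddSubgroup Q :=
    (((Contra.restrictScalars f hf).obj Q).timSubmodule (T.I n)).toAddSubgroup.comap
      (Contra.restrictEquiv f hf Q : Q →+ _) ⊔ (Q.timSubmodule (T.J (n + 1))).toAddSubgroup
  have hspan : ∀ s ∈ Submodule.span Sᵐᵒᵖ (f '' (T.I n : Set R)), ∀ x : Q, s • x ∈ E := by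
    intro s hs
    induction hs using Submodule.span_induction with
    | mem s hs =>
      obtain ⟨r, hr, rfl⟩ := hs
      intro x
      refine AddSubgroup.mem_sup_left ?_
      change Contra.restrictEquiv f hf Q (f r • x) ∈ _
      rw [Contra.restrictEquiv_smul]
      exact Contra.smul_mem_tim _ hr _
    | zero => intro x; rw [zero_smul]; exact E.zero_mem
    | add s t _ _ hs ht => intro x; rw [add_smul]; exact E.add_mem (hs x) (ht x)
    | smul c s _ hs =>
      intro x
      rw [← op_unop c, op_smul_eq_mul, mul_smul]
      exact hs _
  have hJ : ∀ s ∈ T.J n, ∀ x : Q, s • x ∈ E := by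
    intro s hs x
    have hs' : s ∈ closure (Submodule.span Sᵐᵒᵖ (f '' (T.I n : Set R)) : Set S) := by
      rw [← T.closure_eq n]; exact hs
    have hnhds : (fun t => s - t) ⁻¹' (T.J (n + 1) : Set S) ∈ 𝓝 s :=
      ((T.isOpen_J (n + 1)).preimage (continuous_const.sub continuous_id)).mem_nhds (by simp)
    obtain ⟨t, hts, ht⟩ := mem_closure_iff_nhds.1 hs' _ hnhds
    rw [← add_sub_cancel t s, add_smul]
    exact E.add_mem (hspan t ht x) (AddSubgroup.mem_sup_right (Q.smul_mem_tim hts x))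
  -- Modulo coefficients in `Jₙ₊₁` the formal sum representing `q` is finite, so the statement for
  -- single products suffices.
  have hqE : q ∈ E := by
    obtain ⟨c, hc, rfl⟩ := hq
    obtain ⟨s, hs⟩ := FormalSum.exists_finset_sub_mem (T.isOpen_J (n + 1)) c
    rw [← add_sub_cancel (∑ y ∈ s, c.1 y • FormalSum.single y) c, Q.act_add]
    refine E.add_mem ?_ (AddSubgroup.mem_sup_right (Q.act_mem_timSubmodule hs))
    rw [← Contra.actHom_apply, map_sum]
    exact sum_mem fun y _ => hJ _ (hc y) y
  obtain ⟨x, ⟨a, ha, hax⟩, y, hy, rfl⟩ := AddSubgroup.mem_sup.1 hqE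
  refine ⟨a, ha, ?_⟩
  rw [show Q.act (FormalSum.mapCoeff f hf a) = x from hax, add_sub_cancel_left]
  exact hy

/-- For a separated left `S`-contramodule `Q`, one has `Jₙ ⋌ Q = Iₙ ⋌ Q`. -/
theorem mem_restrict_timSubmodule {Q : Contra.{u, v} S} (hQ : Contra.IsSeparated Q) {n : ℕ}
    {q : Q} (hq : q ∈ Q.timSubmodule (T.J n)) :
    Contra.restrictEquiv f hf Q q ∈
      ((Contra.restrictScalars f hf).obj Q).timSubmodule (T.I n) := by
  choose! a ha hsub using fun m (q : Q) (hq : q ∈ Q.timSubmodule (T.J m)) =>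
    T.exists_sub_mem hf Q hq
  -- `x k` is the error after `k` corrections; it lies in `Jₙ₊ₖ ⋌ Q`.
  let x : ℕ → Q := fun k =>
    Nat.rec q (fun k y => y - Q.act (FormalSum.mapCoeff f hf (a (n + k) y))) k
  have hx : ∀ k, x k ∈ Q.timSubmodule (T.J (n + k)) := fun k => by
    induction k with
    | zero => exact hq
    | succ k ih => exact hsub _ _ ih
  have hshift : StrictMono fun k => n + k := fun k l h => Nat.add_lt_add_left h n
  obtain ⟨b, hb⟩ := FormalSum.exists_series (I := fun k => T.I (n + k)) (fun k => T.isOpen_I _)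
    (T.basis_I.comp_strictMono hshift) (fun k => a (n + k) (x k)) fun k => ha _ _ (hx k)
  -- At index `0` the partial sum is empty, so `hb 0` says that the coefficients of `b` themselves
  -- lie in `Iₙ`.
  refine ⟨b, fun y => by simpa using hb 0 y, ?_⟩
  change Q.act (FormalSum.mapCoeff f hf b) = q
  rw [← sub_eq_zero]
  let φ : FormalSum R Q →+ Q :=
    AddMonoidHom.mk' (fun a => Q.act (FormalSum.mapCoeff f hf a)) fun a b => by
      rw [FormalSum.mapCoeff_add, Q.act_add]
  refine hQ.eq_zero (T.basis_J.comp_strictMono hshift) fun k => ?_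
  have h1 : φ (b - ∑ i ∈ Finset.range k, a (n + i) (x i)) ∈ Q.timSubmodule (T.J (n + k)) :=
    T.restrict_timSubmodule_le hf Q ⟨_, hb k, rfl⟩
  -- The corrections telescope to `q - x k`, so `φ b - q` lies in `Jₙ₊ₖ ⋌ Q` for every `k`.
  have h2 : ∑ i ∈ Finset.range k, φ (a (n + i) (x i)) = q - x k := by
    have : ∀ i, φ (a (n + i) (x i)) = x i - x (i + 1) := fun i => (sub_sub_cancel _ _).symm
    simp only [this]
    exact Finset.sum_range_sub' x k
  rw [map_sub, map_sum, h2] at h1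
  have h3 := Submodule.sub_mem _ h1 (hx k)
  rwa [sub_sub, sub_add_cancel] at h3

end TautChain

end Taut

/-! ### The additive structure on contramodule morphisms -/

section Additive

variable {R : Type u} [Ring R] [UniformSpace R] [IsUniformAddGroup R] [IsTopologicalRing R]
  [IsLinearTopology Rᵐᵒᵖ R] [CompleteSpace R] [T2Space R] {X Y : Type*}

namespace FormalSum

theorem bind_add_right (a : FormalSum R X) (k l : X → FormalSum R Y) :
    bind a (fun x => k x + l x) = bind a k + bind a l := by
  refine Subtype.ext (funext fun y => ?_)
  change ∑' x, a.1 x * ((k x).1 y + (l x).1 y) = _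
  simp only [mul_add]
  exact ((summing_self R).summable ((summing_self R).tendsto a fun x => (k x).1 y)).tsum_add
    ((summing_self R).summable ((summing_self R).tendsto a fun x => (l x).1 y))

theorem bind_zero_right (a : FormalSum R X) : bind a (fun _ => (0 : FormalSum R Y)) = 0 := by
  simpa using bind_add_right a (fun _ => (0 : FormalSum R Y)) fun _ => 0

theorem bind_neg_right (a : FormalSum R X) (k : X → FormalSum R Y) :
    bind a (fun x => -k x) = -bind a k := by
  have := bind_add_right a (fun x => -k x) k
  simp only [neg_add_cancel, bind_zero_right] at this
  exact eq_neg_of_add_eq_zero_left this.symm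

end FormalSum

namespace Contra

variable {P Q : Contra.{u, v} R}

theorem Hom.map_add (g : P ⟶ Q) (x y : P) : g (x + y) = g x + g y := by
  refine (Hom.map_act g _).trans ?_
  rw [FormalSum.map_add, FormalSum.map_single, FormalSum.map_single]
  rfl

theorem Hom.map_smul (g : P ⟶ Q) (r : R) (x : P) : g (r • x) = r • g x := by
  refine (Hom.map_act g _).trans ?_
  rw [FormalSum.map_smul, FormalSum.map_single]
  rfl

/-- Each coefficient of the image formal sum is an infinite sum of elements of `I`, and the open
ideal `I` is closed. -/
theorem Hom.map_timSubmodule (g : P ⟶ Q) {I : Ideal R} (hI : IsOpen (I : Set R)) {x : P}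
    (hx : x ∈ P.timSubmodule I) : g x ∈ Q.timSubmodule I := by
  obtain ⟨a, ha, rfl⟩ := hx
  exact ⟨_, FormalSum.map_apply_mem hI g.toFun ha, (Hom.map_act g a).symm⟩

/-- Pointwise zero, sum and negative are themselves contraaction values, so contraassociativity in
this form shows that pointwise operations on morphisms give morphisms. -/
theorem act_map_act {X : Type*} (a : FormalSum R X) (k : X → FormalSum R Q) :
    Q.act (FormalSum.map (fun x => Q.act (k x)) a) = Q.act (FormalSum.bind a k) :=
  (Q.act_bind a k).symm

instance : Zero (P ⟶ Q) where
  zero := ⟨fun _ => 0, fun a => by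
    refine Eq.symm ((Q.act_map_act a fun _ => 0).trans ?_)
    rw [FormalSum.bind_zero_right]
    rfl⟩

instance : Add (P ⟶ Q) where
  add g h := ⟨fun x => g x + h x, fun a => by
    refine Eq.symm ((Q.act_map_act a
      fun x => FormalSum.single (g x) + FormalSum.single (h x)).trans ?_)
    rw [FormalSum.bind_add_right, Q.act_add, ← FormalSum.map_eq_bind, ← FormalSum.map_eq_bind,
      Hom.map_act, Hom.map_act]⟩

instance : Neg (P ⟶ Q) where
  neg g := ⟨fun x => -g x, fun a => by
    refine Eq.symm ((Q.act_map_act a fun x => -FormalSum.single (g x)).trans ?_)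
    rw [FormalSum.bind_neg_right, Q.act_neg, ← FormalSum.map_eq_bind, Hom.map_act]⟩

instance : AddCommGroup (P ⟶ Q) where
  add_assoc g h k := Hom.ext (funext fun _ => add_assoc _ _ _)
  zero_add g := Hom.ext (funext fun _ => zero_add _)
  add_zero g := Hom.ext (funext fun _ => add_zero _)
  add_comm g h := Hom.ext (funext fun _ => add_comm _ _)
  nsmul := nsmulRec
  neg_add_cancel g := Hom.ext (funext fun _ => neg_add_cancel _)
  zsmul := zsmulRec

end Contra

end Additive

/-! ### The module of morphisms from `S` -/

section HomFrom

variable {R S : Type u}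
  [Ring R] [UniformSpace R] [IsUniformAddGroup R] [IsTopologicalRing R]
  [Ring S] [UniformSpace S] [IsUniformAddGroup S] [IsTopologicalRing S]
  [IsLinearTopology Rᵐᵒᵖ R] [CompleteSpace R] [T2Space R]
  [IsLinearTopology Sᵐᵒᵖ S] [CompleteSpace S] [T2Space S]
  {f : R →+* S} {hf : Continuous f} {P : Contra.{u, u} R}

namespace HomFrom

theorem ext_eval {g h : HomFrom f hf P} (H : ∀ s, g.eval s = h.eval s) : g = h :=
  Contra.Hom.ext (funext H)

theorem eval_add (h : HomFrom f hf P) (s t : S) : h.eval (s + t) = h.eval s + h.eval t := by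
  refine Eq.trans (congrArg (Contra.Hom.toFun h) ?_) (Contra.Hom.map_add h s t)
  exact (Contra.self_add (R := S) s t).symm.trans
    ((Contra.restrictEquiv f hf (Contra.self S)).map_add s t)

theorem eval_map_mul (h : HomFrom f hf P) (r : R) (s : S) :
    h.eval (f r * s) = r • h.eval s := by
  refine Eq.trans (congrArg (Contra.Hom.toFun h) ?_) (Contra.Hom.map_smul h r s)
  exact (Contra.self_smul (f r) s).symm.trans
    (Contra.restrictEquiv_smul f hf (Contra.self S) r s)

/-- Here tautness enters: `Jₙ = Jₙ ⋌ S = Iₙ ⋌ S` because `S` is a separated contramodule over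
itself, and morphisms over `R` preserve `Iₙ ⋌ -`. -/
theorem eval_mem (T : TautChain f) (h : HomFrom f hf P) {n : ℕ} {s : S} (hs : s ∈ T.J n) :
    h.eval s ∈ P.timSubmodule (T.I n) :=
  Contra.Hom.map_timSubmodule h (T.isOpen_I n)
    (T.mem_restrict_timSubmodule hf Contra.isSeparated_self
      ((Contra.mem_timSubmodule_self (T.isOpen_J n)).2 hs))

/-- An `R`-linear map `S → P` taking `Jₙ` into `Iₙ ⋌ P` is a morphism of contramodules. -/
def ofLinear (hP : Contra.IsSeparated P) (T : TautChain f) (φ : S → P)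
    (hadd : ∀ s t, φ (s + t) = φ s + φ t) (hmul : ∀ r s, φ (f r * s) = r • φ s)
    (hmem : ∀ n, ∀ s ∈ T.J n, φ s ∈ P.timSubmodule (T.I n)) : HomFrom f hf P where
  toFun := φ
  map_act a := by
    rw [← sub_eq_zero]
    refine hP.eq_zero T.basis_I fun n => ?_
    refine Contra.map_act_sub_mem (M := (Contra.restrictScalars f hf).obj (Contra.self S)) φ
      (fun s t => ?_) (fun r s => ?_) (T.isOpen_I n) (P.timSubmodule (T.I n)).toAddSubgroup
      (fun x hx => hx) (fun s hs => ?_) a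
    · refine (congrArg φ ?_).trans (hadd s t)
      exact ((Contra.self_add (R := S) s t).symm.trans
        ((Contra.restrictEquiv f hf (Contra.self S)).map_add s t)).symm
    · refine (congrArg φ ?_).trans (hmul r s)
      exact ((Contra.self_smul (f r) (show Contra.self S from s)).symm.trans
        (Contra.restrictEquiv_smul f hf (Contra.self S) r s)).symm
    · exact hmem n s ((Contra.mem_timSubmodule_self (T.isOpen_J n)).1
        (T.restrict_timSubmodule_le hf (Contra.self S) hs))

theorem add_eval (g h : HomFrom f hf P) (s : S) : (g + h).eval s = g.eval s + h.eval s := rfl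

theorem sub_eval (g h : HomFrom f hf P) (s : S) : (g - h).eval s = g.eval s - h.eval s := by
  rw [sub_eq_add_neg, sub_eq_add_neg]; rfl

/-- Right multiplication by `s` is the endomorphism of the left contramodule `S` sending `1` to `s`;
precomposing with it needs no new check of the morphism property. -/
instance : SMul S (HomFrom f hf P) where
  smul s g := (Contra.restrictScalars f hf).map ((Contra.evalOne (Contra.self S)).symm s) ≫ g

theorem smul_eval (s : S) (g : HomFrom f hf P) (t : S) : (s • g).eval t = g.eval (t * s) :=
  congrArg (Contra.Hom.toFun g) (Contra.self_smul t (show Contra.self S from s))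

theorem eval_zero (h : HomFrom f hf P) : h.eval 0 = 0 := by
  simpa using h.eval_add 0 0

instance : Module S (HomFrom f hf P) where
  one_smul g := ext_eval fun t => by rw [smul_eval, mul_one]
  mul_smul s s' g := ext_eval fun t => by rw [smul_eval, smul_eval, smul_eval, mul_assoc]
  smul_zero s := ext_eval fun t => by rw [smul_eval]; rfl
  smul_add s g h := ext_eval fun t => by simp only [smul_eval, add_eval]
  add_smul s s' g := ext_eval fun t => by simp only [smul_eval, add_eval, mul_add, eval_add]
  zero_smul g := ext_eval fun t => by rw [smul_eval, mul_zero, eval_zero]; rfl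

/-- The morphisms from `S` to `P` taking values in a subgroup of `P`. -/
def valuedIn (P' : AddSubgroup P) : AddSubgroup (HomFrom f hf P) where
  carrier := {h | ∀ s, h.eval s ∈ P'}
  zero_mem' _ := P'.zero_mem
  add_mem' hg hh s := P'.add_mem (hg s) (hh s)
  neg_mem' hg s := P'.neg_mem (hg s)

/-- The filtration of `Hom^R(S, P)` by the submodules of morphisms with values in `Iₙ ⋌ P`. -/
def filtration (hP : Contra.IsSeparated P) (T : TautChain f) :
    CompleteFiltration (HomFrom f hf P) where
  sub n := valuedIn (P.timSubmodule (T.I n)).toAddSubgroup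
  antitone m n hmn h hh s := P.timSubmodule_mono (T.basis_I.antitone hmn) (hh s)
  eq_zero h hh := ext_eval fun s => hP.eq_zero T.basis_I fun n => hh n s
  exists_limit x hx := by
    have hlim := fun s => P.exists_limit T.isOpen_I T.basis_I (fun n => (x n).eval s) fun n => by
      have := hx n s
      rwa [sub_eval] at this
    -- The limit is taken pointwise. Linearity holds modulo every `Iₙ ⋌ P`, hence exactly, and `y`
    -- sends `Jₙ` into `Iₙ ⋌ P` because it differs from `x n` by values there.
    choose y hy using hlim
    refine ⟨ofLinear hP T y (fun s t => ?_) (fun r s => ?_) (fun n s hs => ?_), fun n s => ?_⟩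
    · rw [← sub_eq_zero]
      refine hP.eq_zero T.basis_I fun n => ?_
      have := Submodule.sub_mem _ (hy (s + t) n) (Submodule.add_mem _ (hy s n) (hy t n))
      rw [eval_add] at this
      convert this using 1
      abel
    · rw [← sub_eq_zero]
      refine hP.eq_zero T.basis_I fun n => ?_
      have := Submodule.sub_mem _ (hy (f r * s) n) (Submodule.smul_mem _ r (hy s n))
      rw [eval_map_mul, smul_sub] at this
      convert this using 1
      abel
    · exact (Submodule.sub_mem_iff_left _ (eval_mem T (x n) hs)).1 (hy s n)
    · rw [sub_eval]
      exact hy s n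

theorem summing (hP : Contra.IsSeparated P) (T : TautChain f) :
    @Summing S _ _ (HomFrom f hf P) _ _ (filtration hP T).uniformSpace :=
  (filtration hP T).summing (fun s n h hh t => by rw [smul_eval]; exact hh _)
    fun n => ⟨T.J n, (T.isOpen_J n).mem_nhds (T.J n).zero_mem, fun s hs h t => by
      rw [smul_eval]
      exact eval_mem T h ((T.J n).mul_mem_left t hs)⟩

variable (hf) in
/-- The left `S`-contramodule `Hom^R(S, P)`. -/
def contra (hP : Contra.IsSeparated P) (T : TautChain f) : Contra.{u, u} S :=
  ⟨HomFrom f hf P, (filtration hP T).contraStr (summing hP T)⟩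

/-- The underlying module of the contramodule `Hom^R(S, P)`. -/
def contraEquiv (hP : Contra.IsSeparated P) (T : TautChain f) :
    HomFrom f hf P ≃ₗ[S] contra hf hP T where
  toFun h := h
  invFun h := h
  map_add' g h := (CompleteFiltration.contraStr_act_single_add_single (summing hP T) g h).symm
  map_smul' s g := (CompleteFiltration.contraStr_act_smul_single (summing hP T) s g).symm

/-- Two chains occur: `T` defines the infinite sums and `T'` measures their size. Some ideal of `T`
lies in `T'.I n`, so the target subgroup is open in the topology of `T`; this makes reduction along
an arbitrary chain possible. -/
theorem act_mem_valuedIn (hP : Contra.IsSeparated P) (T T' : TautChain f) {n : ℕ}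
    {a : FormalSum S (HomFrom f hf P)} (ha : ∀ h, a.1 h ∈ T'.J n) :
    (contra hf hP T).str.act a ∈
      valuedIn (f := f) (hf := hf) (P.timSubmodule (T'.I n)).toAddSubgroup := by
  obtain ⟨m, -, hm⟩ :=
    T.basis_I.1.mem_iff.1 ((T'.isOpen_I n).mem_nhds (T'.I n).zero_mem)
  refine CompleteFiltration.contraStr_act_mem (summing hP T) (n := m) ?_ a fun h t => ?_
  · exact fun h hh s => P.timSubmodule_mono hm (hh s)
  · rw [smul_eval]
    exact eval_mem T' h ((T'.J n).mul_mem_left t (ha h))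

theorem contra_isSeparated (hP : Contra.IsSeparated P) (T : TautChain f) :
    Contra.IsSeparated (contra hf hP T) := by
  intro h hh
  -- The zero of `contra hf hP T` is a contraaction value and has to be identified with the zero
  -- morphism.
  have h0 := map_zero (contraEquiv (hf := hf) hP T)
  refine Eq.trans ((filtration hP T).eq_zero h fun n => ?_) h0
  obtain ⟨a, ha, rfl⟩ := hh
    { (T.J n).toAddSubgroup with smul_mem' := fun c x hx => (T.J n).mul_mem_right _ hx }
    (T.isOpen_J n)
  exact act_mem_valuedIn hP T T ha

/-- A criterion for maps into `Hom^R(S, P)` to be morphisms of contramodules. -/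
theorem map_act_eq (hP : Contra.IsSeparated P) (T : TautChain f) {M : Contra.{u, u} S}
    (g : M → HomFrom f hf P) (hadd : ∀ x y, g (x + y) = g x + g y)
    (hsmul : ∀ (s : S) x, g (s • x) = s • g x)
    (hM : ∀ n, ∀ x ∈ M.timSubmodule (T.J n), ∀ s, (g x).eval s ∈ P.timSubmodule (T.I n))
    (a : FormalSum S M) : g (M.act a) = (contra hf hP T).str.act (FormalSum.map g a) := by
  refine sub_eq_zero.1 ((filtration hP T).eq_zero (g (M.act a) -
    (show HomFrom f hf P from (contra hf hP T).str.act (FormalSum.map g a))) fun n => ?_)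
  let N' : AddSubgroup (contra hf hP T) :=
    ((filtration hP T).sub n).comap
      ((contraEquiv hP T).symm.toAddEquiv : contra hf hP T →+ HomFrom f hf P)
  have := Contra.map_act_sub_mem (N := contra hf hP T) g
    (fun x y => (hadd x y).trans (map_add (contraEquiv hP T) (g x) (g y)))
    (fun s x => (hsmul s x).trans (map_smul (contraEquiv hP T) s (g x)))
    (T.isOpen_J n) N' (fun x hx => ?_) (fun x hx => hM n x hx) a
  · have h2 := (contraEquiv (hf := hf) hP T).symm.map_sub (contraEquiv hP T (g (M.act a)))
      ((contra hf hP T).act (FormalSum.map g a))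
    exact Eq.mp (congrArg (· ∈ (filtration hP T).sub n) h2) this
  · obtain ⟨b, hb, rfl⟩ := hx
    exact act_mem_valuedIn hP T T hb

end HomFrom

end HomFrom

/-! ### The coextension of scalars -/

/-! ### Operations on discrete modules viewed as contramodules -/

section OfModule

variable {R : Type u} [Ring R] [UniformSpace R] [IsUniformAddGroup R] [IsTopologicalRing R]
  [IsLinearTopology Rᵐᵒᵖ R] [CompleteSpace R] [T2Space R]
  {M : Type v} [AddCommGroup M] {J : Ideal R} [J.IsTwoSided] [Module (R ⧸ J) M]
  (hJ : IsOpen (J : Set R))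

namespace Contra

theorem ofModule_act (a : FormalSum R M) :
    @Eq M ((ofModule M J hJ).str.act a) (∑ᶠ m : M, Ideal.Quotient.mk J (a.1 m) • m) := rfl

theorem ofModule_add (x y : M) :
    @Eq M ((show ofModule M J hJ from x) + (show ofModule M J hJ from y)) (x + y) := by
  have hs : ∀ m : M,
      ∑ᶠ m' : M, Ideal.Quotient.mk J ((FormalSum.single (R := R) m).1 m') • m' = m :=
    fun m => (ofModule M J hJ).str.act_single m
  refine (ofModule_act hJ (FormalSum.single x + FormalSum.single y)).trans ?_
  refine Eq.trans ?_ (congrArg₂ (· + ·) (hs x) (hs y))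
  refine (finsum_congr fun m => ?_).trans
    (finsum_add_distrib (finite_support_act J hJ _) (finite_support_act J hJ _))
  exact (congrArg (· • m) (map_add (Ideal.Quotient.mk J) _ _)).trans (add_smul _ _ _)

theorem ofModule_smul (r : R) (x : M) :
    @Eq M (r • (show ofModule M J hJ from x)) (Ideal.Quotient.mk J r • x) := by
  refine (ofModule_act hJ (r • FormalSum.single (X := M) x)).trans ?_
  change ∑ᶠ m : M, Ideal.Quotient.mk J (r * (FormalSum.single (R := R) x).1 m) • m = _
  rw [finsum_eq_single _ x fun y hy => by simp [FormalSum.single, hy]]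
  simp [FormalSum.single]

theorem ofModule_act_eq_zero {a : FormalSum R M} (ha : ∀ m, a.1 m ∈ J) :
    @Eq M ((ofModule M J hJ).str.act a) 0 := by
  refine (ofModule_act hJ a).trans ((finsum_congr fun m => ?_).trans finsum_zero)
  rw [Ideal.Quotient.eq_zero_iff_mem.2 (ha m), zero_smul]

theorem ofModule_zero : @Eq M (0 : ofModule M J hJ) 0 :=
  ofModule_act_eq_zero hJ (a := 0) fun _ => J.zero_mem

end Contra

end OfModule

section Coextension

variable {R S : Type u}
  [Ring R] [UniformSpace R] [IsUniformAddGroup R] [IsTopologicalRing R]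
  [Ring S] [UniformSpace S] [IsUniformAddGroup S] [IsTopologicalRing S]
  [IsLinearTopology Rᵐᵒᵖ R] [CompleteSpace R] [T2Space R]
  [IsLinearTopology Sᵐᵒᵖ S] [CompleteSpace S] [T2Space S]
  {f : R →+* S} {hf : Continuous f}

/-! ### Reduction to the quotient rings and the limit description -/

namespace TautChain

variable {T : TautChain f} {P : Contra.{u, u} R} {n : ℕ}

theorem mk_smul_mk (r : R) (p : P) :
    Ideal.Quotient.mk (T.I n) r • (Submodule.Quotient.mk p : P ⧸ P.timSubmodule (T.I n)) =
      Submodule.Quotient.mk (r • p) := rfl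

namespace homModule

theorem ext_eval {g h : T.homModule P n} (H : ∀ x, eval g x = eval h x) : g = h :=
  ModuleCat.CoextendScalars.ext (LinearMap.ext H)

theorem eval_add (g : T.homModule P n) (x y : S ⧸ T.J n) :
    eval g (x + y) = eval g x + eval g y :=
  map_add (ModuleCat.CoextendScalars.equiv _ _ g) x y

theorem eval_quotientMap_mul (g : T.homModule P n) (r : R ⧸ T.I n) (x : S ⧸ T.J n) :
    eval g (T.quotientMap n r * x) = r • eval g x :=
  (ModuleCat.CoextendScalars.equiv _ _ g).map_smul r x

theorem add_eval (g h : T.homModule P n) (x : S ⧸ T.J n) :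
    eval (g + h) x = eval g x + eval h x := rfl

theorem smul_eval (s : S ⧸ T.J n) (g : T.homModule P n) (x : S ⧸ T.J n) :
    eval (s • g) x = eval g (x * s) := rfl

theorem zero_eval (x : S ⧸ T.J n) : eval (0 : T.homModule P n) x = 0 := rfl

/-- An `Rₙ`-linear map `Sₙ → Pₙ` as an element of `Hom_{Rₙ}(Sₙ, Pₙ)`. -/
def ofLinear (φ : S ⧸ T.J n → P ⧸ P.timSubmodule (T.I n))
    (hadd : ∀ x y, φ (x + y) = φ x + φ y)
    (hmul : ∀ r x, φ (T.quotientMap n r * x) = r • φ x) : T.homModule P n :=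
  (ModuleCat.CoextendScalars.equiv _ _).symm
    { toFun := φ
      map_add' := hadd
      map_smul' := hmul }

end homModule

/-- Independence of the chosen representative, since `h` maps `Jₙ` into `Iₙ ⋌ P`. It justifies
defining `reduce` through `Quotient.out`. -/
theorem mk_eval_out (h : HomFrom f hf P) (s : S) :
    (Submodule.Quotient.mk (h.eval (Quotient.out (Ideal.Quotient.mk (T.J n) s))) :
      P ⧸ P.timSubmodule (T.I n)) = Submodule.Quotient.mk (h.eval s) := by
  have hs : Quotient.out (Ideal.Quotient.mk (T.J n) s) - s ∈ T.J n :=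
    Ideal.Quotient.eq.1 (Quotient.out_eq _)
  have h2 := h.eval_add (Quotient.out (Ideal.Quotient.mk (T.J n) s) - s) s
  rw [sub_add_cancel] at h2
  rw [Submodule.Quotient.eq, h2, add_sub_cancel_right]
  exact HomFrom.eval_mem T h hs

/-- The map `Hom^R(S, P) → Hom_{Rₙ}(Sₙ, Pₙ)` induced by passage to the quotients. -/
def reduce (T : TautChain f) (n : ℕ) (h : HomFrom f hf P) : T.homModule P n :=
  homModule.ofLinear (fun x => Submodule.Quotient.mk (h.eval (Quotient.out x)))
    (fun x y => by
      obtain ⟨s, rfl⟩ := Ideal.Quotient.mk_surjective x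
      obtain ⟨t, rfl⟩ := Ideal.Quotient.mk_surjective y
      rw [← map_add, mk_eval_out, mk_eval_out, mk_eval_out, HomFrom.eval_add]
      rfl)
    (fun r x => by
      obtain ⟨s, rfl⟩ := Ideal.Quotient.mk_surjective x
      obtain ⟨r, rfl⟩ := Ideal.Quotient.mk_surjective r
      rw [show T.quotientMap n (Ideal.Quotient.mk _ r) = Ideal.Quotient.mk _ (f r) from rfl,
        ← map_mul, mk_eval_out, mk_eval_out, HomFrom.eval_map_mul]
      rfl)

theorem eval_reduce (h : HomFrom f hf P) (s : S) :
    homModule.eval (T.reduce n h) (Ideal.Quotient.mk (T.J n) s) =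
      Submodule.Quotient.mk (h.eval s) :=
  mk_eval_out h s

/-- The morphism of `S`-contramodules `Hom^R(S, P) → Hom_{Rₙ}(Sₙ, Pₙ)`. -/
def reduceHom (hP : Contra.IsSeparated P) (T₀ T : TautChain f) (n : ℕ) :
    HomFrom.contra hf hP T₀ ⟶ T.homContra P n where
  toFun := T.reduce n
  map_act a := by
    let e := HomFrom.contraEquiv (hf := hf) hP T₀
    -- With the subgroup `⊥` the congruence becomes an equality: `Jₙ ⋌ -` vanishes in an
    -- `Sₙ`-module, and elements of `Jₙ ⋌ Hom^R(S, P)` take values in `Iₙ ⋌ P`, so they reduce to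
    -- zero.
    have key := Contra.map_act_sub_mem (M := HomFrom.contra hf hP T₀) (N := T.homContra P n)
      (T.reduce n) (fun g h => ?_) (fun s g => ?_) (T.isOpen_J n) ⊥ ?_ ?_ a
    · exact sub_eq_zero.1 key
    · refine Eq.trans ?_ (Contra.ofModule_add (T.isOpen_J n) (T.reduce n g) (T.reduce n h)).symm
      refine (congrArg (T.reduce n) (e.map_add (e.symm g) (e.symm h)).symm).trans ?_
      change T.reduce n (e.symm g + e.symm h) = T.reduce n (e.symm g) + T.reduce n (e.symm h)
      refine homModule.ext_eval fun x => ?_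
      obtain ⟨t, rfl⟩ := Ideal.Quotient.mk_surjective x
      rw [homModule.add_eval, eval_reduce, eval_reduce, eval_reduce]
      rfl
    · refine Eq.trans ?_ (Contra.ofModule_smul (T.isOpen_J n) s (T.reduce n g)).symm
      refine (congrArg (T.reduce n) (e.map_smul s (e.symm g)).symm).trans ?_
      change T.reduce n (s • e.symm g) = Ideal.Quotient.mk (T.J n) s • T.reduce n (e.symm g)
      refine homModule.ext_eval fun x => ?_
      obtain ⟨t, rfl⟩ := Ideal.Quotient.mk_surjective x
      rw [homModule.smul_eval, ← map_mul, eval_reduce, eval_reduce]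
      exact congrArg _ (HomFrom.smul_eval s (e.symm g) t)
    · rintro _ ⟨b, hb, rfl⟩
      exact (Contra.ofModule_act_eq_zero (M := T.homModule P n) (T.isOpen_J n) hb).trans
        (Contra.ofModule_zero (M := T.homModule P n) (T.isOpen_J n)).symm
    · rintro _ ⟨b, hb, rfl⟩
      refine Eq.trans (b := (0 : T.homModule P n)) (homModule.ext_eval fun x => ?_)
        (Contra.ofModule_zero (M := T.homModule P n) (T.isOpen_J n)).symm
      obtain ⟨t, rfl⟩ := Ideal.Quotient.mk_surjective x
      rw [homModule.zero_eval]
      refine (eval_reduce _ t).trans ((Submodule.Quotient.mk_eq_zero _).2 ?_)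
      exact HomFrom.act_mem_valuedIn hP T₀ T hb t

/-- For each `s`, compatibility makes lifts to `P` of the values of the `g n` a convergent sequence.
Separatedness makes the limit unique, hence linear in `s`. -/
theorem existsUnique_reduce_eq (hP : Contra.IsSeparated P) (T : TautChain f)
    (g : ∀ n, T.homModule P n) (hg : ∀ n, T.Compatible P n (g (n + 1)) (g n)) :
    ∃! h : HomFrom f hf P, ∀ n, T.reduce n h = g n := by
  have hlim : ∀ s : S, ∃ p : P, ∀ n,
      (Submodule.Quotient.mk p : P ⧸ P.timSubmodule (T.I n)) =
        homModule.eval (g n) (Ideal.Quotient.mk _ s) := fun s => by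
    choose p hp using fun n =>
      Submodule.Quotient.mk_surjective _ (homModule.eval (g n) (Ideal.Quotient.mk _ s))
    obtain ⟨q, hq⟩ := P.exists_limit T.isOpen_I T.basis_I p fun n => by
      have h := hg n (Ideal.Quotient.mk _ s)
      rw [← hp (n + 1)] at h
      exact (Submodule.Quotient.eq _).1 (h.trans (hp n).symm)
    exact ⟨q, fun n => ((Submodule.Quotient.eq _).2 (hq n)).trans (hp n)⟩
  have huniq : ∀ p q : P, (∀ n, (Submodule.Quotient.mk p : P ⧸ P.timSubmodule (T.I n)) =
      Submodule.Quotient.mk q) → p = q := fun p q h =>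
    sub_eq_zero.1 (hP.eq_zero T.basis_I fun n => (Submodule.Quotient.eq _).1 (h n))
  choose φ hφ using hlim
  refine ⟨HomFrom.ofLinear hP T φ (fun s t => huniq _ _ fun n => ?_)
    (fun r s => huniq _ _ fun n => ?_) (fun n s hs => ?_), fun n => ?_, fun h hh => ?_⟩
  · rw [hφ, map_add, homModule.eval_add, ← hφ, ← hφ]
    rfl
  · rw [hφ, map_mul, ← mk_smul_mk, hφ]
    exact homModule.eval_quotientMap_mul (g n) (Ideal.Quotient.mk _ r) _
  -- On `Jₙ` the reduction of `φ` is `g n` at zero, which vanishes by additivity.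
  · rw [← Submodule.Quotient.mk_eq_zero, hφ, Ideal.Quotient.eq_zero_iff_mem.2 hs]
    simpa using homModule.eval_add (g n) 0 0
  · refine homModule.ext_eval fun x => ?_
    obtain ⟨t, rfl⟩ := Ideal.Quotient.mk_surjective x
    rw [eval_reduce]
    exact hφ t n
  · refine HomFrom.ext_eval fun s => huniq _ _ fun n => ?_
    rw [← eval_reduce, hh n]
    exact (hφ s n).symm

end TautChain

/-! ### The coextension functor and the adjunction -/

variable (hf) in
/-- The contramodule structures on the sets `Hom^R(S, P)` defined by a taut chain. -/
def TautChain.coextension (T : TautChain f) : CoextensionStructure f hf where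
  str P := (HomFrom.contra hf P.property T).str
  separated P := HomFrom.contra_isSeparated P.property T
  natural {P P'} g a := by
    let e := HomFrom.contraEquiv (hf := hf) P.property T
    refine HomFrom.map_act_eq P'.property T (M := HomFrom.contra hf P.property T)
      (fun h : HomFrom f hf P.obj => h ≫ g.hom) (fun h k => ?_) (fun s h => ?_) ?_ a
    · refine (congrArg (fun h : HomFrom f hf P.obj => h ≫ g.hom)
        (e.map_add (e.symm h) (e.symm k)).symm).trans ?_
      exact HomFrom.ext_eval fun t => Contra.Hom.map_add g.hom _ _
    · refine (congrArg (fun h : HomFrom f hf P.obj => h ≫ g.hom)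
        (e.map_smul s (e.symm h)).symm).trans ?_
      refine HomFrom.ext_eval fun t => ?_
      rw [HomFrom.smul_eval]
      exact congrArg g.hom.toFun (HomFrom.smul_eval s (e.symm h) t)
    · rintro n _ ⟨b, hb, rfl⟩ s
      exact Contra.Hom.map_timSubmodule g.hom (T.isOpen_I n)
        (HomFrom.act_mem_valuedIn P.property T T hb s)

variable (hf) in
/-- The morphism `Q → Hom^R(S, Q)` taking `q` to the map `s ↦ s q`. -/
def TautChain.unitHom (T : TautChain f) (Q : SepContra.{u, u} S) :
    Q.obj ⟶ HomFrom.contra hf ((SepContra.restrictScalars f hf).obj Q).property T where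
  toFun q := (Contra.restrictScalars f hf).map ((Contra.evalOne Q.obj).symm q)
  map_act a := by
    refine HomFrom.map_act_eq ((SepContra.restrictScalars f hf).obj Q).property T
      (fun q => (Contra.restrictScalars f hf).map ((Contra.evalOne Q.obj).symm q))
      (fun p q => ?_) (fun s q => ?_) (fun n q hq s => ?_) a
    · refine HomFrom.ext_eval fun t => ?_
      exact (smul_add t p q).trans ((Contra.restrictEquiv f hf Q.obj).map_add _ _)
    · refine HomFrom.ext_eval fun t => ?_
      refine Eq.trans ?_ (HomFrom.smul_eval s (P := ((SepContra.restrictScalars f hf).obj Q).obj)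
        ((Contra.restrictScalars f hf).map ((Contra.evalOne Q.obj).symm q)) t).symm
      exact (mul_smul t s q).symm
    -- Tautness is used again, for `Q` itself: `s q` lies in `Jₙ ⋌ Q = Iₙ ⋌ Q`.
    · exact T.mem_restrict_timSubmodule hf Q.property (Submodule.smul_mem _ s hq)

/-- The morphism `Hom^R(S, P) → P` taking `h` to `h(1)`. -/
def TautChain.counitHom {P : Contra.{u, u} R} (hP : Contra.IsSeparated P) (T : TautChain f) :
    (Contra.restrictScalars f hf).obj (HomFrom.contra hf hP T) ⟶ P where
  toFun h := HomFrom.eval (f := f) (hf := hf) h 1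
  map_act a := by
    rw [← sub_eq_zero]
    refine hP.eq_zero T.basis_I fun n => ?_
    let e := HomFrom.contraEquiv (hf := hf) hP T
    let e' := Contra.restrictEquiv f hf (HomFrom.contra hf hP T)
    refine Contra.map_act_sub_mem
      (M := (Contra.restrictScalars f hf).obj (HomFrom.contra hf hP T))
      (fun h => HomFrom.eval (f := f) (hf := hf) h 1) (fun g h => ?_) (fun r h => ?_)
      (T.isOpen_I n) (P.timSubmodule (T.I n)).toAddSubgroup (fun x hx => hx)
      (fun h hh => ?_) a
    · refine congrArg (fun h => HomFrom.eval (f := f) (hf := hf) h 1)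
        (a₂ := e.symm (e'.symm g) + e.symm (e'.symm h)) ?_
      exact (e'.map_add (e'.symm g) (e'.symm h)).symm.trans
          (e.map_add (e.symm (e'.symm g)) (e.symm (e'.symm h))).symm
    · refine (congrArg (fun h => HomFrom.eval (f := f) (hf := hf) h 1)
        (a₂ := f r • e.symm (e'.symm h)) ?_).trans ?_
      · exact (Contra.restrictEquiv_smul f hf (HomFrom.contra hf hP T) r (e'.symm h)).symm.trans
          (e.map_smul (f r) (e.symm (e'.symm h))).symm
      -- Evaluation at `1` is `R`-linear: `(f(r)h)(1) = h(f(r)) = r h(1)`.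
      · rw [HomFrom.smul_eval, one_mul, ← mul_one (f r), HomFrom.eval_map_mul]
        rfl
    · obtain ⟨b, hb, hbh⟩ := T.restrict_timSubmodule_le hf (HomFrom.contra hf hP T) hh
      exact hbh ▸ HomFrom.act_mem_valuedIn hP T T hb 1

variable (hf) in
/-- The adjunction between restriction of scalars and `P ↦ Hom^R(S, P)`. -/
def TautChain.adjunction (T : TautChain f) :
    SepContra.restrictScalars f hf ⊣ (T.coextension hf).functor where
  unit :=
    { app := fun Q => ⟨T.unitHom hf Q⟩
      naturality := fun Q Q' g => by
        refine InducedCategory.hom_ext (Contra.Hom.ext (funext fun q => ?_))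
        refine HomFrom.ext_eval fun t => ?_
        exact (Contra.Hom.map_smul g.hom t q).symm }
  counit :=
    { app := fun P => ⟨T.counitHom P.property⟩
      naturality := fun P P' g => rfl }
  left_triangle_components Q := by
    refine InducedCategory.hom_ext (Contra.Hom.ext (funext fun q => ?_))
    exact one_smul S (show Q.obj from q)
  right_triangle_components P := by
    refine InducedCategory.hom_ext (Contra.Hom.ext (funext fun h => ?_))
    refine HomFrom.ext_eval fun t => ?_
    let e := HomFrom.contraEquiv (hf := hf) P.property T
    change HomFrom.eval (f := f) (hf := hf) (t • (show HomFrom.contra hf P.property T from h)) 1 = _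
    refine (congrArg (fun h => HomFrom.eval (f := f) (hf := hf) h 1)
      (e.map_smul t (e.symm h)).symm).trans ?_
    refine (HomFrom.smul_eval t (e.symm h) 1).trans ?_
    rw [one_mul]
    rfl

end Coextension

end Contramodules

end

open Contramodules in
theorem mainTheorem6 {R S : Type u}
    [Ring R] [UniformSpace R] [IsUniformAddGroup R] [IsTopologicalRing R]
    [IsLinearTopology R R] [IsLinearTopology Rᵐᵒᵖ R] [CompleteSpace R] [T2Space R]
    [(𝓝 (0 : R)).IsCountablyGenerated]
    [Ring S] [UniformSpace S] [IsUniformAddGroup S] [IsTopologicalRing S]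
    [IsLinearTopology S S] [IsLinearTopology Sᵐᵒᵖ S] [CompleteSpace S] [T2Space S]
    [(𝓝 (0 : S)).IsCountablyGenerated]
    (f : R →+* S) (hf : Continuous f) (hft : StronglyRightTaut f) :
    ∃ C : CoextensionStructure f hf,
      -- The underlying left `S`-module of the contramodule is the usual one.
      (∀ (P : SepContra.{u, u} R) (g h : (C.functor.obj P).obj) (s t : S),
        HomFrom.eval (P := P.obj) (hf := hf) (g + h) t =
          HomFrom.eval (P := P.obj) (hf := hf) g t + HomFrom.eval (P := P.obj) (hf := hf) h t ∧
        HomFrom.eval (P := P.obj) (hf := hf) (s • g) t =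
          HomFrom.eval (P := P.obj) (hf := hf) g (t * s)) ∧
      -- It is the limit of the contramodules `Hom_{Rₙ}(Sₙ, Pₙ)`.
      Nonempty (TautChain f) ∧
      (∀ (T : TautChain f) (P : SepContra.{u, u} R),
        ∃ ρ : ∀ n, (C.functor.obj P).obj ⟶ T.homContra P.obj n,
          (∀ (n : ℕ) (h : HomFrom f hf P.obj) (s : S),
            TautChain.homModule.eval (T := T) (P := P.obj) (ρ n h) (Ideal.Quotient.mk (T.J n) s) =
              Submodule.Quotient.mk (h.eval s)) ∧
          ∀ g : ∀ n, T.homModule P.obj n,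
            (∀ n, T.Compatible P.obj n (g (n + 1)) (g n)) →
              ∃! h : HomFrom f hf P.obj, ∀ n, ρ n h = g n) ∧
      -- It is right adjoint to restriction of scalars, the counit being induced by `f`.
      ∃ adj : SepContra.restrictScalars f hf ⊣ C.functor,
        ∀ (P : SepContra.{u, u} R) (h : HomFrom f hf P.obj),
          Contra.Hom.toFun (adj.counit.app P).hom h =
            Contra.evalOne P.obj (Contra.selfMap f hf ≫ h) := by
  -- `T₀` only serves to define the contramodule structures; the limit statement is proved for every
  -- chain `T` against them.
  obtain ⟨T₀⟩ := TautChain.nonempty hf hft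
  refine ⟨T₀.coextension hf, fun P g h s t => ?_, ⟨T₀⟩, fun T P => ?_, T₀.adjunction hf,
    fun P h => ?_⟩
  · let e := HomFrom.contraEquiv (hf := hf) P.property T₀
    exact ⟨congrArg (fun k => HomFrom.eval (f := f) (hf := hf) k t)
        (e.map_add (e.symm g) (e.symm h)).symm,
      (congrArg (fun k => HomFrom.eval (f := f) (hf := hf) k t)
        (e.map_smul s (e.symm g)).symm).trans (HomFrom.smul_eval s (e.symm g) t)⟩
  · exact ⟨TautChain.reduceHom P.property T₀ T, fun n h s => TautChain.eval_reduce h s,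
      T.existsUnique_reduce_eq P.property⟩
  -- The two sides are `h(1)` and `h(f(1))`.
  · exact congrArg (Contra.Hom.toFun h) (map_one f).symm
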